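/- Let $1<p<\infty$ and $p'=p/(p-1)$. Let $\gamma>0$ if $1<p\le 3$, and $2\gamma\ge p-3$ if $p>3$. Let $q\in L_{\gamma+3/2}(\mathbb R^3)$ be complex-valued, and let $q=ab$ almost everywhere be a factorization into measurable functions of Stummel classes, that is, $$\sup_x\int_{|x-y|<1}|a(y)|^{p'}|x-y|^{\nu-3}\,dy<\infty\ \text{ for some } 0<\nu<p',\qquad \sup_x\int_{|x-y|<1}|b(y)|^{p}|x-y|^{\mu-3}\,dy<\infty\ \text{ for some } 0<\mu<p$$ (for instance $a=|q|^{1/2}$, $b=\operatorname{sign}(q)|q|^{1/2}$, where $\operatorname{sign}q=q/|q|$ if $q\neq0$ and $\operatorname{sign}q=0$ otherwise, whenever these satisfy the two conditions). In $L_p(\mathbb R^3)$ let $H_0=-\Delta$ with domain the Sobolev space $W_p^2(\mathbb R^3)$, let $R(z;H_0)=(H_0-z)^{-1}$, let $A,B$ be the operators of multiplication by $a,b$ with maximal domains, let $[R(z;H_0)A]$ and $Q(z)$ be the closures (bounded extensions) of $R(z;H_0)A$ and $BR(z;H_0)A$. The Schrödinger operator $H$ is the closed extension of $H_0+AB=-\Delta+q$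 determined by $$(H-z)^{-1}=R(z;H_0)-[R(z;H_0)A]\,(I+Q(z))^{-1}\,B\,R(z;H_0),$$ where $z\in\mathbb C\setminus[0,\infty)$ is any point at which $I+Q(z)$ has a bounded everywhere defined inverse. Then every eigenvalue $\lambda\in\mathbb C\setminus[0,\infty)$ of $H$, written as $\lambda=|\lambda|e^{i\theta}$ with $0<\theta<2\pi$, satisfies $$|\lambda|^{\gamma}\le C(\gamma,\theta)\int_{\mathbb R^3}|q(x)|^{\gamma+3/2}\,dx,$$ where $$C(\gamma,\theta)=\frac{1}{4\pi\,\sin^{2\gamma}(\theta/2)}\Bigl(\frac{2\gamma+1}{2\gamma+3}\Bigr)^{2\gamma}\,\Gamma\Bigl(\frac{4\gamma}{2\gamma+1}\Bigr)^{(2\gamma+1)/2}.$$ -/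

import Mathlib

open MeasureTheory TemperedDistribution
open scoped ENNReal SchwartzMap LineDeriv Laplacian

noncomputable section

/-- Three-dimensional Euclidean space `ℝ³`. -/
abbrev R3 : Type := EuclideanSpace ℝ (Fin 3)

/-- The complex Lebesgue space `L_p(ℝ³)`. -/
abbrev LpR3 (p : ℝ≥0∞) : Type := Lp ℂ p (volume : Measure R3)

/-! ### Unbounded operators: composition, scalars, regular points, eigenvalues -/

section Operators

variable {E : Type*} [NormedAddCommGroup E] [NormedSpace ℂ E]

/-- The graph of the product `g f` of two unbounded operators, on its natural domain
`{u ∈ D(f) : f u ∈ D(g)}`. -/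
def compGraph (g f : E →ₗ.[ℂ] E) : Submodule ℂ (E × E) where
  carrier := {x | ∃ v, (x.1, v) ∈ f.graph ∧ (v, x.2) ∈ g.graph}
  zero_mem' := ⟨0, f.graph.zero_mem, g.graph.zero_mem⟩
  add_mem' := by
    rintro x y ⟨v, hv, hv'⟩ ⟨w, hw, hw'⟩
    exact ⟨v + w, f.graph.add_mem hv hw, g.graph.add_mem hv' hw'⟩
  smul_mem' := by
    rintro c x ⟨v, hv, hv'⟩
    exact ⟨c • v, f.graph.smul_mem c hv, g.graph.smul_mem c hv'⟩

/-- The product `g f` of two unbounded operators, on the domain `{u ∈ D(f) : f u ∈ D(g)}`. -/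
def opComp (g f : E →ₗ.[ℂ] E) : E →ₗ.[ℂ] E := (compGraph g f).toLinearPMap

theorem opComp_graph (g f : E →ₗ.[ℂ] E) : (opComp g f).graph = compGraph g f := by
  refine Submodule.toLinearPMap_graph_eq _ ?_
  rintro x ⟨v, hv, hv'⟩ hx
  rw [hx] at hv
  have hv0 : v = 0 := f.graph_fst_eq_zero_snd hv rfl
  rw [hv0] at hv'
  exact g.graph_fst_eq_zero_snd hv' rfl

/-- The operator `c I`, defined on the whole space. -/
def scalarOp (E : Type*) [NormedAddCommGroup E] [NormedSpace ℂ E] (c : ℂ) : E →ₗ.[ℂ] E :=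
  (c • LinearMap.id : E →ₗ[ℂ] E).toPMap ⊤

/-- `z` is a regular point of `T` (a point of its resolvent set): `T - z I` is a bijection of
`D(T)` onto the whole space, and its inverse is a bounded operator `S`. -/
def IsRegularPoint (T : E →ₗ.[ℂ] E) (z : ℂ) : Prop :=
  ∃ S : E →L[ℂ] E, ∀ u f : E, (u, f) ∈ (T - scalarOp E z).graph ↔ u = S f

/-- The resolvent `(T - z I)⁻¹`, as an operator with domain the range of `T - z I`. -/
def resolventOp (T : E →ₗ.[ℂ] E) (z : ℂ) : E →ₗ.[ℂ] E := (T - scalarOp E z).inverse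

/-- `l` is an eigenvalue of the unbounded operator `T`. -/
def IsEigenvalue (T : E →ₗ.[ℂ] E) (l : ℂ) : Prop :=
  ∃ u : T.domain, (u : E) ≠ 0 ∧ T u = l • (u : E)

end Operators

/-! ### The operators `H₀`, `A`, `B` in `L_p(ℝ³)` -/

/-- The tempered distribution `T` is given by a function of `L_p(ℝ³)`. -/
def IsLpFunction (p : ℝ≥0∞) [Fact (1 ≤ p)] (T : 𝓢'(R3, ℂ)) : Prop :=
  ∃ f : LpR3 p, (f : 𝓢'(R3, ℂ)) = T

theorem IsLpFunction.zero (p : ℝ≥0∞) [Fact (1 ≤ p)] : IsLpFunction p 0 :=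
  ⟨0, map_zero (Lp.toTemperedDistributionCLM ℂ volume p)⟩

theorem IsLpFunction.add {p : ℝ≥0∞} [Fact (1 ≤ p)] {S T : 𝓢'(R3, ℂ)}
    (hS : IsLpFunction p S) (hT : IsLpFunction p T) : IsLpFunction p (S + T) := by
  obtain ⟨f, rfl⟩ := hS
  obtain ⟨g, rfl⟩ := hT
  exact ⟨f + g, map_add (Lp.toTemperedDistributionCLM ℂ volume p) f g⟩

theorem IsLpFunction.smul {p : ℝ≥0∞} [Fact (1 ≤ p)] (c : ℂ) {T : 𝓢'(R3, ℂ)}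
    (hT : IsLpFunction p T) : IsLpFunction p (c • T) := by
  obtain ⟨f, rfl⟩ := hT
  exact ⟨c • f, map_smul (Lp.toTemperedDistributionCLM ℂ volume p) c f⟩

/-- The Sobolev space `W_p²(ℝ³)`: the functions of `L_p(ℝ³)` all of whose distributional
derivatives of order one and two belong to `L_p(ℝ³)`. -/
def sobolevW2 (p : ℝ≥0∞) [Fact (1 ≤ p)] : Submodule ℂ (LpR3 p) where
  carrier := {u | (∀ m : R3, IsLpFunction p (∂_{m} (u : 𝓢'(R3, ℂ)))) ∧
    ∀ m n : R3, IsLpFunction p (∂_{m} (∂_{n} (u : 𝓢'(R3, ℂ))))}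
  zero_mem' := by
    have h0 : ((0 : LpR3 p) : 𝓢'(R3, ℂ)) = 0 :=
      map_zero (Lp.toTemperedDistributionCLM ℂ volume p)
    refine ⟨fun m => ?_, fun m n => ?_⟩
    · rw [h0, LineDeriv.lineDerivOp_zero]
      exact IsLpFunction.zero p
    · rw [h0, LineDeriv.lineDerivOp_zero, LineDeriv.lineDerivOp_zero]
      exact IsLpFunction.zero p
  add_mem' := by
    intro u v hu hv
    have h0 : ((u + v : LpR3 p) : 𝓢'(R3, ℂ)) = (u : 𝓢'(R3, ℂ)) + (v : 𝓢'(R3, ℂ)) :=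
      map_add (Lp.toTemperedDistributionCLM ℂ volume p) u v
    refine ⟨fun m => ?_, fun m n => ?_⟩
    · rw [h0, LineDeriv.lineDerivOp_add]
      exact (hu.1 m).add (hv.1 m)
    · rw [h0, LineDeriv.lineDerivOp_add, LineDeriv.lineDerivOp_add]
      exact (hu.2 m n).add (hv.2 m n)
  smul_mem' := by
    intro c u hu
    have h0 : ((c • u : LpR3 p) : 𝓢'(R3, ℂ)) = c • (u : 𝓢'(R3, ℂ)) :=
      map_smul (Lp.toTemperedDistributionCLM ℂ volume p) c u
    refine ⟨fun m => ?_, fun m n => ?_⟩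
    · rw [h0, LineDeriv.lineDerivOp_smul]
      exact (hu.1 m).smul c
    · rw [h0, LineDeriv.lineDerivOp_smul, LineDeriv.lineDerivOp_smul]
      exact (hu.2 m n).smul c

/-- The graph of `H₀`: the pairs `(u, f)` with `u ∈ W_p²(ℝ³)` and `f = -Δu`. -/
def freeGraph (p : ℝ≥0∞) [Fact (1 ≤ p)] : Submodule ℂ (LpR3 p × LpR3 p) where
  carrier := {x | x.1 ∈ sobolevW2 p ∧ (x.2 : 𝓢'(R3, ℂ)) = -Δ (x.1 : 𝓢'(R3, ℂ))}
  zero_mem' := by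
    refine ⟨Submodule.zero_mem _, ?_⟩
    have h0 : ((0 : LpR3 p) : 𝓢'(R3, ℂ)) = 0 :=
      map_zero (Lp.toTemperedDistributionCLM ℂ volume p)
    have h1 : Δ (0 : 𝓢'(R3, ℂ)) = 0 := by
      simpa only [laplacianCLM_apply] using
        map_zero (LineDeriv.laplacianCLM ℂ R3 𝓢'(R3, ℂ))
    change ((0 : LpR3 p) : 𝓢'(R3, ℂ)) = -Δ ((0 : LpR3 p) : 𝓢'(R3, ℂ))
    rw [h0, h1, neg_zero]
  add_mem' := by
    rintro x y ⟨hx, hx'⟩ ⟨hy, hy'⟩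
    refine ⟨Submodule.add_mem _ hx hy, ?_⟩
    have h0 (u v : LpR3 p) :
        ((u + v : LpR3 p) : 𝓢'(R3, ℂ)) = (u : 𝓢'(R3, ℂ)) + (v : 𝓢'(R3, ℂ)) :=
      map_add (Lp.toTemperedDistributionCLM ℂ volume p) u v
    have h1 (S T : 𝓢'(R3, ℂ)) : Δ (S + T) = Δ S + Δ T :=
      by
      simpa only [laplacianCLM_apply] using
        map_add (LineDeriv.laplacianCLM ℂ R3 𝓢'(R3, ℂ)) S T
    change ((x.2 + y.2 : LpR3 p) : 𝓢'(R3, ℂ)) = -Δ ((x.1 + y.1 : LpR3 p) : 𝓢'(R3, ℂ))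
    rw [h0, h0, h1, hx', hy', neg_add]
  smul_mem' := by
    rintro c x ⟨hx, hx'⟩
    refine ⟨Submodule.smul_mem _ c hx, ?_⟩
    have h0 (u : LpR3 p) : ((c • u : LpR3 p) : 𝓢'(R3, ℂ)) = c • (u : 𝓢'(R3, ℂ)) :=
      map_smul (Lp.toTemperedDistributionCLM ℂ volume p) c u
    have h1 (T : 𝓢'(R3, ℂ)) : Δ (c • T) = c • Δ T :=
      by
      simpa only [laplacianCLM_apply] using
        map_smul (LineDeriv.laplacianCLM ℂ R3 𝓢'(R3, ℂ)) c T
    change ((c • x.2 : LpR3 p) : 𝓢'(R3, ℂ)) = -Δ ((c • x.1 : LpR3 p) : 𝓢'(R3, ℂ))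
    rw [h0, h0, h1, hx', smul_neg]

/-- The unperturbed operator `H₀ = -Δ` in `L_p(ℝ³)` with domain `W_p²(ℝ³)`. -/
def freeOp (p : ℝ≥0∞) [Fact (1 ≤ p)] : LpR3 p →ₗ.[ℂ] LpR3 p := (freeGraph p).toLinearPMap

theorem freeOp_graph (p : ℝ≥0∞) [Fact (1 ≤ p)] : (freeOp p).graph = freeGraph p := by
  refine Submodule.toLinearPMap_graph_eq _ ?_
  rintro ⟨u, f⟩ ⟨-, hf⟩ hu
  have h0 : ((0 : LpR3 p) : 𝓢'(R3, ℂ)) = 0 :=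
    map_zero (Lp.toTemperedDistributionCLM ℂ volume p)
  have h1 : Δ (0 : 𝓢'(R3, ℂ)) = 0 := by
      simpa only [laplacianCLM_apply] using
        map_zero (LineDeriv.laplacianCLM ℂ R3 𝓢'(R3, ℂ))
  change u = 0 at hu
  change (f : 𝓢'(R3, ℂ)) = -Δ (u : 𝓢'(R3, ℂ)) at hf
  rw [hu, h0, h1, neg_zero] at hf
  have hker := Lp.ker_toTemperedDistributionCLM_eq_bot (E := R3) (F := ℂ) (μ := volume) (p := p)
  exact (LinearMap.ker_eq_bot'.mp hker) f hf

/-- The graph of the operator of multiplication by `a`: the pairs `(u, f)` of elements of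
`L_p(ℝ³)` with `f = a u` almost everywhere. -/
def mulGraph (p : ℝ≥0∞) [Fact (1 ≤ p)] (a : R3 → ℂ) : Submodule ℂ (LpR3 p × LpR3 p) where
  carrier := {x | ∀ᵐ y ∂(volume : Measure R3), x.2 y = a y * x.1 y}
  zero_mem' := by
    change ∀ᵐ y ∂(volume : Measure R3), (0 : LpR3 p) y = a y * (0 : LpR3 p) y
    filter_upwards [Lp.coeFn_zero ℂ p (volume : Measure R3)] with y hy
    rw [hy, Pi.zero_apply, mul_zero]
  add_mem' := by
    intro u v hu hv
    change ∀ᵐ y ∂(volume : Measure R3), (u.2 + v.2 : LpR3 p) y = a y * (u.1 + v.1 : LpR3 p) y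
    filter_upwards [hu, hv, Lp.coeFn_add u.1 v.1, Lp.coeFn_add u.2 v.2] with y h1 h2 h3 h4
    rw [h3, h4, Pi.add_apply, Pi.add_apply, h1, h2, mul_add]
  smul_mem' := by
    intro c u hu
    change ∀ᵐ y ∂(volume : Measure R3), (c • u.2 : LpR3 p) y = a y * (c • u.1 : LpR3 p) y
    filter_upwards [hu, Lp.coeFn_smul c u.1, Lp.coeFn_smul c u.2] with y h1 h3 h4
    rw [h3, h4, Pi.smul_apply, Pi.smul_apply, h1, smul_eq_mul, smul_eq_mul, mul_left_comm]

/-- The operator of multiplication by `a` in `L_p(ℝ³)` with its maximal domain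
`{u ∈ L_p(ℝ³) : a u ∈ L_p(ℝ³)}`. -/
def mulOp (p : ℝ≥0∞) [Fact (1 ≤ p)] (a : R3 → ℂ) : LpR3 p →ₗ.[ℂ] LpR3 p :=
  (mulGraph p a).toLinearPMap

theorem mulOp_graph (p : ℝ≥0∞) [Fact (1 ≤ p)] (a : R3 → ℂ) :
    (mulOp p a).graph = mulGraph p a := by
  refine Submodule.toLinearPMap_graph_eq _ ?_
  rintro ⟨u, f⟩ huf hu
  change u = 0 at hu
  change ∀ᵐ y ∂(volume : Measure R3), f y = a y * u y at huf
  change f = 0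
  refine Lp.ext ?_
  filter_upwards [huf, Lp.coeFn_zero ℂ p (volume : Measure R3)] with y h1 h2
  rw [h1, hu, h2, Pi.zero_apply, mul_zero]

/-! ### The Schrödinger operator -/

/-- The Stummel quantity `M_{ν,s}(u) = sup_x ∫_{|x-y|<1} |u(y)|^s |x-y|^{ν-3} dy`. -/
def stummelM (ν s : ℝ) (u : R3 → ℂ) : ℝ≥0∞ :=
  ⨆ x : R3, ∫⁻ y in Metric.ball x 1, ‖u y‖ₑ ^ s * ENNReal.ofReal (‖x - y‖ ^ (ν - 3))

/-- `u` is of Stummel class for the exponent `s`: `M_{ν,s}(u) < ∞` for some `0 < ν < s`. -/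
def IsStummel (s : ℝ) (u : R3 → ℂ) : Prop :=
  AEStronglyMeasurable u (volume : Measure R3) ∧ ∃ ν : ℝ, 0 < ν ∧ ν < s ∧ stummelM ν s u < ⊤

/-- The closure of `R(z; H₀) A`. When `R(z; H₀) A` is bounded, this is its bounded extension. -/
def resolventMul (p : ℝ≥0∞) [Fact (1 ≤ p)] (a : R3 → ℂ) (z : ℂ) : LpR3 p →ₗ.[ℂ] LpR3 p :=
  (opComp (resolventOp (freeOp p) z) (mulOp p a)).closure

/-- The bordered resolvent `Q(z)`: the closure of `B R(z; H₀) A`. When `B R(z; H₀) A` is bounded,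
this is its bounded extension. -/
def borderedResolvent (p : ℝ≥0∞) [Fact (1 ≤ p)] (a b : R3 → ℂ) (z : ℂ) :
    LpR3 p →ₗ.[ℂ] LpR3 p :=
  (opComp (mulOp p b) (opComp (resolventOp (freeOp p) z) (mulOp p a))).closure

/-- The perturbed resolvent
`R(z; H) = R(z; H₀) - [R(z; H₀) A] (I + Q(z))⁻¹ B R(z; H₀)`. -/
def perturbedResolvent (p : ℝ≥0∞) [Fact (1 ≤ p)] (a b : R3 → ℂ) (z : ℂ) :
    LpR3 p →ₗ.[ℂ] LpR3 p :=
  resolventOp (freeOp p) z -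
    opComp (resolventMul p a z)
      (opComp (resolventOp (borderedResolvent p a b z) (-1))
        (opComp (mulOp p b) (resolventOp (freeOp p) z)))

/-- The Schrödinger operator `H` in `L_p(ℝ³)`, the closed extension of `H₀ + A B` (that is, of
`-Δ + a b`) whose resolvent at `z` is `perturbedResolvent p a b z`. Here `z` is an auxiliary point
outside `[0, ∞)`, the spectrum of `H₀`, at which `I + Q(z)` is boundedly invertible; `H` does not depend on its choice. -/
def schrodingerOp (p : ℝ≥0∞) [Fact (1 ≤ p)] (a b : R3 → ℂ) (z : ℂ) : LpR3 p →ₗ.[ℂ] LpR3 p :=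
  (perturbedResolvent p a b z).inverse + scalarOp (LpR3 p) z

/-- The constant `C(γ, θ)`. -/
def lapSafConst (γ θ : ℝ) : ℝ :=
  1 / (4 * Real.pi * Real.sin (θ / 2) ^ (2 * γ)) *
    ((2 * γ + 1) / (2 * γ + 3)) ^ (2 * γ) *
    Real.Gamma (4 * γ / (2 * γ + 1)) ^ ((2 * γ + 1) / 2)

end

/-! Write the auxiliary point as `z = -κ²` and the eigenvalue as `l = -μ²`, with `Re κ, Re μ > 0`.
The free resolvent at `-κ²` is convolution with the Yukawa potential `G_κ`. Unwinding the formula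
for the resolvent of `H`, an eigenfunction `u` satisfies `u = (κ² - μ²) G_κ * u - G_κ * g` with `g =
q u` (`exists_of_mem_graph_perturbedResolvent`). The resolvent identity then moves the parameter
from `κ` to `μ` and gives `u = -G_μ * g` (`ae_eq_neg_yukawaConv`, `exists_eigenfunction`).

Multiplying by `q` gives `|g| = |q| |G_μ * g|`, so a Schur estimate bounds the `L_1` norm of `g` by
itself times `sup_y ∫ |G_μ(x - y)| |q(x)| dx`. Hölder with exponents `s = (2γ+3)/(2γ+1)` and `r = γ
+ 3/2` bounds the supremum by `‖G_μ‖_s ‖q‖_r`, and `‖G_μ‖_s` is a Gamma integral, finite because `γ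
> 0` means `s < 3`. If the claimed inequality failed, this product would be below 1, forcing `g = 0`
and `u = 0` (`lintegral_yukawa_mul_lt_one`, `ae_eq_zero_of_yukawa_equation`).

In general `g` is not known to be integrable. It has the form `a w` with `w ∈ L_p` and `a` locally
uniformly in `L_{p'}`, so `e^{-ε|x|} g` is integrable for every `ε > 0`. The estimates therefore
carry this weight, which costs only a replacement of `μ` by `μ - ε` in the kernel
(`norm_yukawa_mul_exp_le`); strictness of the inequality absorbs the loss. -/

noncomputable section

open Set Filter Topology FourierTransform

/-! ### Bounds on the resolvent symbol; `L_s` norms of the Yukawa potential -/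

/-- The Yukawa potential `e^{-κ|x|} / (4π|x|)`, the kernel of the resolvent of `-Δ` at `-κ²`. -/
def yukawa (κ : ℂ) (x : R3) : ℂ := Complex.exp (-κ * (‖x‖ : ℂ)) / (4 * Real.pi * ‖x‖ : ℝ)

/-- Factor `t + κ² = (κ + i√t)(κ - i√t)`; both factors have real part `Re κ`. -/
theorem sq_re_le_norm_add_sq {κ : ℂ} (hκ : 0 < κ.re) {t : ℝ} (ht : 0 ≤ t) :
    κ.re ^ 2 ≤ ‖(t : ℂ) + κ ^ 2‖ := by
  have hs : ((Real.sqrt t : ℝ) : ℂ) ^ 2 = t := by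
    rw [← Complex.ofReal_pow, Real.sq_sqrt ht]
  have h : (t : ℂ) + κ ^ 2 = (κ + Real.sqrt t * Complex.I) * (κ - Real.sqrt t * Complex.I) := by
    rw [← hs]; ring_nf; rw [Complex.I_sq]; ring
  have h1 := Complex.abs_re_le_norm (κ + Real.sqrt t * Complex.I)
  have h2 := Complex.abs_re_le_norm (κ - Real.sqrt t * Complex.I)
  simp only [Complex.add_re, Complex.sub_re, Complex.mul_re, Complex.ofReal_re, Complex.I_re,
    mul_zero, Complex.ofReal_im, Complex.I_im, mul_one, sub_zero, add_zero, abs_of_pos hκ] at h1 h2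
  rw [h, norm_mul, sq]
  gcongr

theorem iteratedDeriv_inv_add_const (c : ℂ) (n : ℕ) {t : ℝ} (ht : (t : ℂ) + c ≠ 0) :
    iteratedDeriv n (fun t : ℝ => ((t : ℂ) + c)⁻¹) t
      = (-1) ^ n * (n.factorial : ℂ) * (((t : ℂ) + c)⁻¹) ^ (n + 1) := by
  induction n generalizing t with
  | zero => simp
  | succ n ih =>
    rw [iteratedDeriv_succ]
    have hopen : IsOpen {t : ℝ | (t : ℂ) + c ≠ 0} :=
      isOpen_ne_fun (by fun_prop) continuous_const
    have hev : iteratedDeriv n (fun t : ℝ => ((t : ℂ) + c)⁻¹) =ᶠ[𝓝 t]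
        fun t : ℝ => (-1) ^ n * (n.factorial : ℂ) * (((t : ℂ) + c)⁻¹) ^ (n + 1) := by
      filter_upwards [hopen.mem_nhds ht] with s hs using ih hs
    rw [hev.deriv_eq]
    have h1 : HasDerivAt (fun t : ℝ => ((t : ℂ) + c)) 1 t :=
      Complex.ofRealCLM.hasDerivAt.add_const c
    have h2 := ((h1.inv ht).pow (n + 1)).const_mul ((-1) ^ n * (n.factorial : ℂ))
    have h3 : (fun t : ℝ => (-1) ^ n * (n.factorial : ℂ) * (((t : ℂ) + c)⁻¹) ^ (n + 1)) =
      fun y => (-1) ^ n * (n.factorial : ℂ) * ((fun t : ℝ => ((t : ℂ) + c))⁻¹ ^ (n + 1)) y := by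
      ext; simp
    rw [h3, h2.deriv]
    simp only [Nat.factorial_succ, Nat.cast_mul, Pi.inv_apply, Nat.add_sub_cancel]
    rw [neg_div, one_div, ← inv_pow]
    push_cast
    ring

/-- The symbol is `s ↦ (s + κ²)⁻¹` composed with the polynomial `4π²|ξ|²`, so it suffices to bound
all derivatives of a function of one real variable. -/
theorem hasTemperateGrowth_resolventSymbol {κ : ℂ} (hκ : 0 < κ.re) :
    (fun ξ : R3 => (((2 * Real.pi) ^ 2 * ‖ξ‖ ^ 2 : ℝ) + κ ^ 2 : ℂ)⁻¹).HasTemperateGrowth := by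
  set δ : ℝ := κ.re ^ 2 with hδ
  have hδ0 : 0 < δ := by positivity
  -- Starting at `-δ/2` instead of 0 gives an open set containing all values of `4π²|ξ|²`, while the
  -- denominator still stays at least `δ/2` away from zero.
  set t : Set ℝ := Ioi (-(δ / 2)) with ht
  have hto : IsOpen t := isOpen_Ioi
  have hlow : ∀ s ∈ t, δ / 2 ≤ ‖(s : ℂ) + κ ^ 2‖ := by
    intro s hs
    rcases le_or_gt 0 s with h0 | h0
    · have := sq_re_le_norm_add_sq hκ h0
      linarith
    · have h1 := sq_re_le_norm_add_sq hκ le_rfl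
      have h2 : ‖((0 : ℝ) : ℂ) + κ ^ 2‖ ≤ ‖(s : ℂ) + κ ^ 2‖ + ‖(-s : ℂ)‖ := by
        refine le_trans (le_of_eq ?_) (norm_add_le _ _)
        congr 1
        push_cast; ring
      rw [norm_neg, Complex.norm_real, Real.norm_of_nonpos h0.le] at h2
      have h3 : -(δ / 2) < s := hs
      linarith
  have hne : ∀ s ∈ t, (s : ℂ) + κ ^ 2 ≠ 0 := fun s hs h => by
    have := hlow s hs
    rw [h, norm_zero] at this
    linarith
  have hsm : ContDiffOn ℝ (⊤ : ℕ∞) (fun s : ℝ => ((s : ℂ) + κ ^ 2)⁻¹) t := by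
    refine ContDiffOn.inv ?_ hne
    exact (Complex.ofRealCLM.contDiff.add contDiff_const).contDiffOn
  refine Function.HasTemperateGrowth.comp' (g := fun s : ℝ => ((s : ℂ) + κ ^ 2)⁻¹)
    (f := fun ξ : R3 => (2 * Real.pi) ^ 2 * ‖ξ‖ ^ 2) (t := t) ?_ hto.uniqueDiffOn hsm ?_ (by fun_prop)
  · rintro - ⟨ξ, rfl⟩
    have : 0 ≤ (2 * Real.pi) ^ 2 * ‖ξ‖ ^ 2 := by positivity
    simp only [ht, mem_Ioi]
    linarith
  · intro N
    refine ⟨0, ∑ n ∈ Finset.range (N + 1), n.factorial * ((δ / 2)⁻¹) ^ (n + 1), by positivity, ?_⟩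
    intro n hn s hs
    rw [norm_iteratedFDerivWithin_eq_norm_iteratedDerivWithin, iteratedDerivWithin_of_isOpen hto hs,
      iteratedDeriv_inv_add_const _ _ (hne s hs), pow_zero, mul_one]
    refine le_trans ?_ (Finset.single_le_sum (f := fun n : ℕ => (n.factorial : ℝ) * ((δ / 2)⁻¹) ^ (n + 1))
      (fun _ _ => by positivity) (Finset.mem_range.2 (Nat.lt_succ_of_le hn)))
    rw [norm_mul, norm_mul, norm_pow, norm_neg, norm_one, one_pow, one_mul, norm_pow, norm_inv,
      Complex.norm_natCast]
    gcongr
    exact hlow s hs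

theorem measurable_yukawa (κ : ℂ) : Measurable (yukawa κ) := by
  unfold yukawa
  fun_prop

theorem yukawa_neg (κ : ℂ) (x : R3) : yukawa κ (-x) = yukawa κ x := by
  simp [yukawa]

theorem norm_yukawa (κ : ℂ) (x : R3) :
    ‖yukawa κ x‖ = Real.exp (-κ.re * ‖x‖) / (4 * Real.pi * ‖x‖) := by
  rw [yukawa, norm_div, Complex.norm_exp, Complex.norm_real, Real.norm_of_nonneg (by positivity)]
  simp

theorem finrank_R3 : Module.finrank ℝ R3 = 3 := by simp

theorem volume_real_unitBall_R3 : (volume : Measure R3).real (Metric.ball 0 1) = Real.pi * 4 / 3 := by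
  rw [Measure.real, EuclideanSpace.volume_ball_fin_three]
  simp only [ENNReal.ofReal_one, one_pow, one_mul]
  exact ENNReal.toReal_ofReal (by positivity)

/-- Including the Jacobian `y²`, the radial density of `|G|^s` is the integrand of a Gamma integral
with parameter `3 - s`; this is where `s < 3` enters. -/
theorem yukawa_radial_rpow {κ s y : ℝ} (hy : 0 < y) :
    y ^ (3 - 1) • (Real.exp (-κ * y) / (4 * Real.pi * y)) ^ s
      = (4 * Real.pi) ^ (-s) * (y ^ ((3 - s) - 1) * Real.exp (-((s * κ) * y))) := by
  have hpi := Real.pi_pos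
  rw [Real.div_rpow (Real.exp_pos _).le (by positivity), ← Real.exp_mul,
    Real.mul_rpow (by positivity) hy.le, Real.rpow_neg (by positivity),
    show (3 - s) - 1 = ((2 : ℕ) : ℝ) - s by push_cast; ring, Real.rpow_sub hy, Real.rpow_natCast,
    smul_eq_mul, show -κ * y * s = -(s * κ * y) by ring]
  have := Real.rpow_pos_of_pos hy s
  have := Real.rpow_pos_of_pos (show 0 < 4 * Real.pi by positivity) s
  field_simp

theorem integrable_yukawa_rpow {κ : ℂ} (hκ : 0 < κ.re) {s : ℝ} (hs0 : 0 < s) (hs : s < 3) :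
    Integrable (fun x : R3 => ‖yukawa κ x‖ ^ s) := by
  simp_rw [norm_yukawa]
  rw [integrable_fun_norm_addHaar (volume : Measure R3)
    (f := fun y => (Real.exp (-κ.re * y) / (4 * Real.pi * y)) ^ s), finrank_R3]
  refine IntegrableOn.congr_fun (f := fun y : ℝ => (4 * Real.pi) ^ (-s) *
    (y ^ ((3 - s) - 1) * Real.exp (-((s * κ.re) * y)))) ?_
    (fun y hy => (yukawa_radial_rpow hy).symm) measurableSet_Ioi
  refine Integrable.const_mul ?_ _
  have h := integrableOn_rpow_mul_exp_neg_mul_rpow (s := (3 - s) - 1) (p := 1) (b := s * κ.re)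
    (by linarith) one_pos (by positivity)
  simpa only [Real.rpow_one, IntegrableOn, neg_mul] using h

theorem integral_yukawa_rpow {κ : ℂ} (hκ : 0 < κ.re) {s : ℝ} (hs0 : 0 < s) (hs : s < 3) :
    ∫ x : R3, ‖yukawa κ x‖ ^ s
      = (4 * Real.pi) ^ (1 - s) * Real.Gamma (3 - s) * (s * κ.re) ^ (s - 3) := by
  simp_rw [norm_yukawa]
  rw [integral_fun_norm_addHaar (volume : Measure R3)
    (f := fun y => (Real.exp (-κ.re * y) / (4 * Real.pi * y)) ^ s), finrank_R3,
    volume_real_unitBall_R3,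
    setIntegral_congr_fun measurableSet_Ioi (fun y hy => yukawa_radial_rpow hy),
    integral_const_mul, Real.integral_rpow_mul_exp_neg_mul_Ioi (by linarith) (by positivity),
    one_div, Real.inv_rpow (by positivity), ← Real.rpow_neg (by positivity), neg_sub,
    sub_eq_add_neg 1 s, Real.rpow_add (by positivity), Real.rpow_one]
  simp only [nsmul_eq_mul, smul_eq_mul]
  push_cast
  ring

/-! ### The Fourier transform of the Yukawa potential -/

abbrev R2 : Type := EuclideanSpace ℝ (Fin 2)

/-- Cylindrical splitting `ℝ × ℝ² ≃ ℝ³`. -/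
def cylinderEquiv : ℝ × R2 ≃ᵐ R3 :=
  ((MeasurableEquiv.refl ℝ).prodCongr (MeasurableEquiv.toLp 2 (Fin 2 → ℝ)).symm).trans
    ((MeasurableEquiv.piFinSuccAbove (fun _ : Fin 3 => ℝ) 0).symm.trans
      (MeasurableEquiv.toLp 2 (Fin 3 → ℝ)))

theorem measurePreserving_cylinderEquiv :
    MeasurePreserving cylinderEquiv (volume : Measure (ℝ × R2)) (volume : Measure R3) := by
  have h1 : MeasurePreserving (Prod.map (id : ℝ → ℝ) (WithLp.ofLp : R2 → Fin 2 → ℝ))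
      (volume : Measure (ℝ × R2)) (volume : Measure (ℝ × (Fin 2 → ℝ))) :=
    (MeasurePreserving.id volume).prod (PiLp.volume_preserving_ofLp (Fin 2))
  have h2 := (volume_preserving_piFinSuccAbove (fun _ : Fin 3 => ℝ) 0).symm
  exact (PiLp.volume_preserving_toLp (Fin 3)).comp (h2.comp h1)

theorem cylinderEquiv_apply_zero (s : ℝ) (y : R2) : cylinderEquiv (s, y) 0 = s := rfl

theorem norm_cylinderEquiv (s : ℝ) (y : R2) :
    ‖cylinderEquiv (s, y)‖ = Real.sqrt (s ^ 2 + ‖y‖ ^ 2) := by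
  rw [EuclideanSpace.norm_eq, EuclideanSpace.norm_sq_eq, Fin.sum_univ_succ, cylinderEquiv_apply_zero]
  simp only [Real.norm_eq_abs, sq_abs]
  rfl

theorem integrable_yukawa {κ : ℂ} (hκ : 0 < κ.re) : Integrable (yukawa κ) := by
  have h := integrable_yukawa_rpow hκ one_pos (by norm_num)
  simp only [Real.rpow_one] at h
  exact (integrable_norm_iff (measurable_yukawa κ).aestronglyMeasurable).1 h

/-- Integration of the Yukawa potential over a plane at distance `|s|` from the origin. -/
theorem integral_yukawa_plane {κ : ℂ} (hκ : 0 < κ.re) {s : ℝ} (hs : s ≠ 0) :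
    ∫ y : R2, yukawa κ (cylinderEquiv (s, y)) = Complex.exp (-κ * (|s| : ℝ)) / (2 * κ) := by
  have hκ0 : κ ≠ 0 := fun h => by simp [h] at hκ
  have hpos : ∀ ρ : ℝ, 0 < s ^ 2 + ρ ^ 2 := fun ρ => by positivity
  -- `r ρ` is the distance to the origin on the plane at height `s`. Since `r' = ρ/r`, the factor
  -- `ρ` from polar coordinates turns the radial integrand into an exact derivative.
  set r : ℝ → ℝ := fun ρ => Real.sqrt (s ^ 2 + ρ ^ 2) with hr
  have hr0 : ∀ ρ, 0 < r ρ := fun ρ => Real.sqrt_pos.2 (hpos ρ)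
  have hrd : ∀ ρ, HasDerivAt r (ρ / r ρ) ρ := by
    intro ρ
    have h1 : HasDerivAt (fun ρ : ℝ => s ^ 2 + ρ ^ 2) (2 * ρ) ρ := by
      simpa using ((hasDerivAt_id ρ).pow 2).const_add (s ^ 2)
    have h2 := h1.sqrt (hpos ρ).ne'
    convert! h2 using 1
    field_simp [(hr0 ρ).ne']
    rfl
  have hrtop : Tendsto r atTop atTop := by
    refine tendsto_atTop_mono' atTop ?_ tendsto_id
    filter_upwards [eventually_ge_atTop 0] with ρ hρ
    exact Real.le_sqrt_of_sq_le (by simp only [id]; nlinarith [sq_nonneg s])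
  -- the antiderivative
  have hFd : ∀ c : ℂ, c ≠ 0 → ∀ ρ, HasDerivAt (fun ρ => -(c⁻¹) * Complex.exp (-c * (r ρ : ℂ)))
      (((ρ / r ρ : ℝ) : ℂ) * Complex.exp (-c * (r ρ : ℂ))) ρ := by
    intro c hc ρ
    have h1 : HasDerivAt (fun ρ => -c * (r ρ : ℂ)) (-c * ((ρ / r ρ : ℝ) : ℂ)) ρ :=
      (hrd ρ).ofReal_comp.const_mul (-c)
    convert! h1.cexp.const_mul (-(c⁻¹)) using 1
    field_simp
  have hreal : IntegrableOn (fun ρ => (ρ / r ρ) * Real.exp (-κ.re * r ρ)) (Ioi 0) := by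
    refine integrableOn_Ioi_deriv_of_nonneg
      (g := fun ρ => -(κ.re⁻¹) * Real.exp (-κ.re * r ρ)) (l := -(κ.re⁻¹) * 0) ?_ ?_ ?_ ?_
    · have : Continuous r := by fun_prop
      exact Continuous.continuousWithinAt (by fun_prop)
    · intro ρ _
      convert! ((hrd ρ).const_mul (-κ.re)).exp.const_mul (-(κ.re⁻¹)) using 1
      field_simp
    · intro ρ hρ
      have : 0 < ρ := hρ
      have := hr0 ρ
      positivity
    · refine Tendsto.const_mul _ (Real.tendsto_exp_atBot.comp ?_)
      exact hrtop.const_mul_atTop_of_neg (by linarith)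
  have hint : IntegrableOn (fun ρ => ((ρ / r ρ : ℝ) : ℂ) * Complex.exp (-κ * (r ρ : ℂ))) (Ioi 0) := by
    refine (hreal.mono' ?_ ?_)
    · have : Measurable r := by fun_prop
      exact Measurable.aestronglyMeasurable (by fun_prop)
    · filter_upwards [self_mem_ae_restrict measurableSet_Ioi] with ρ hρ
      have h1 : 0 < ρ := hρ
      have h2 := hr0 ρ
      rw [norm_mul, Complex.norm_real, Real.norm_of_nonneg (by positivity), Complex.norm_exp]
      simp
  have htend : Tendsto (fun ρ => -(κ⁻¹) * Complex.exp (-κ * (r ρ : ℂ))) atTop (𝓝 0) := by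
    rw [tendsto_zero_iff_norm_tendsto_zero]
    have h1 : Tendsto (fun ρ => ‖-(κ⁻¹)‖ * Real.exp (-κ.re * r ρ)) atTop (𝓝 (‖-(κ⁻¹)‖ * 0)) := by
      refine Tendsto.const_mul _ (Real.tendsto_exp_atBot.comp ?_)
      exact hrtop.const_mul_atTop_of_neg (by linarith)
    rw [mul_zero] at h1
    refine h1.congr fun ρ => ?_
    rw [norm_mul, Complex.norm_exp]
    simp
  have hI := integral_Ioi_of_hasDerivAt_of_tendsto' (a := 0) (fun ρ _ => hFd κ hκ0 ρ) hint htend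
  have hrad := integral_fun_norm_addHaar (volume : Measure R2)
    (fun ρ => Complex.exp (-κ * (r ρ : ℂ)) / (4 * Real.pi * r ρ : ℝ))
  have hball : (volume : Measure R2).real (Metric.ball 0 1) = Real.pi := by
    rw [Measure.real, EuclideanSpace.volume_ball_fin_two]
    simp [Real.pi_pos.le]
  have hfin : Module.finrank ℝ R2 = 2 := by simp
  rw [hball, hfin] at hrad
  have hleft : (fun y : R2 => yukawa κ (cylinderEquiv (s, y))) =
      fun y => Complex.exp (-κ * (r ‖y‖ : ℂ)) / (4 * Real.pi * r ‖y‖ : ℝ) := by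
    ext y
    rw [yukawa, norm_cylinderEquiv]
  have hscale : ∫ y in Ioi (0 : ℝ), y ^ (2 - 1) • (Complex.exp (-κ * (r y : ℂ)) / (4 * Real.pi * r y : ℝ))
      = (4 * Real.pi : ℂ)⁻¹ * ∫ ρ in Ioi (0 : ℝ), ((ρ / r ρ : ℝ) : ℂ) * Complex.exp (-κ * (r ρ : ℂ)) := by
    rw [← integral_const_mul]
    refine integral_congr_ae (Eventually.of_forall fun ρ => ?_)
    have h1 : (r ρ : ℂ) ≠ 0 := by exact_mod_cast (hr0 ρ).ne'
    have h2 : (Real.pi : ℂ) ≠ 0 := by exact_mod_cast Real.pi_ne_zero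
    simp only [Complex.real_smul]
    push_cast
    field_simp
  have hr00 : r 0 = |s| := by simp [hr, Real.sqrt_sq_eq_abs]
  rw [hleft, hrad, hscale, hI, hr00]
  have h2 : (Real.pi : ℂ) ≠ 0 := by exact_mod_cast Real.pi_ne_zero
  simp only [nsmul_eq_mul, Complex.real_smul]
  push_cast
  field_simp
  ring

theorem integral_exp_neg_abs_mul_exp {κ : ℂ} (hκ : 0 < κ.re) (t : ℝ) :
    ∫ s : ℝ, Complex.exp (((-2 * Real.pi * (s * t) : ℝ) : ℂ) * Complex.I) *
        (Complex.exp (-κ * (|s| : ℝ)) / (2 * κ))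
      = (((2 * Real.pi) ^ 2 * t ^ 2 : ℝ) + κ ^ 2 : ℂ)⁻¹ := by
  have hκ0 : κ ≠ 0 := fun h => by simp [h] at hκ
  set w : ℂ := (2 * Real.pi * t : ℝ) * Complex.I with hw
  have hwre : w.re = 0 := by simp [hw]
  have hm : (-κ - w).re < 0 := by simp [hwre, hκ]
  have hp : 0 < (κ - w).re := by simp [hwre, hκ]
  have e1 : ∀ s ∈ Ioi (0 : ℝ), Complex.exp (((-2 * Real.pi * (s * t) : ℝ) : ℂ) * Complex.I) *
        (Complex.exp (-κ * (|s| : ℝ)) / (2 * κ)) = (2 * κ)⁻¹ * Complex.exp ((-κ - w) * s) := by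
    intro s hs
    rw [abs_of_pos hs, div_eq_mul_inv, ← mul_assoc, ← Complex.exp_add, mul_comm]
    congr 2
    rw [hw]; push_cast; ring
  have e2 : ∀ s ∈ Iic (0 : ℝ), Complex.exp (((-2 * Real.pi * (s * t) : ℝ) : ℂ) * Complex.I) *
        (Complex.exp (-κ * (|s| : ℝ)) / (2 * κ)) = (2 * κ)⁻¹ * Complex.exp ((κ - w) * s) := by
    intro s hs
    rw [abs_of_nonpos hs, div_eq_mul_inv, ← mul_assoc, ← Complex.exp_add, mul_comm]
    congr 2
    rw [hw]; push_cast; ring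
  have i1 : IntegrableOn (fun s : ℝ => (2 * κ)⁻¹ * Complex.exp ((-κ - w) * s)) (Ioi 0) :=
    (integrableOn_exp_mul_complex_Ioi hm 0).const_mul _
  have i2 : IntegrableOn (fun s : ℝ => (2 * κ)⁻¹ * Complex.exp ((κ - w) * s)) (Iic 0) :=
    (integrableOn_exp_mul_complex_Iic hp 0).const_mul _
  rw [← intervalIntegral.integral_Iic_add_Ioi (b := 0)
    (i2.congr_fun (fun s hs => (e2 s hs).symm) measurableSet_Iic)
    (i1.congr_fun (fun s hs => (e1 s hs).symm) measurableSet_Ioi),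
    setIntegral_congr_fun measurableSet_Iic e2, setIntegral_congr_fun measurableSet_Ioi e1,
    integral_const_mul, integral_const_mul, integral_exp_mul_complex_Ioi hm,
    integral_exp_mul_complex_Iic hp]
  have n1 : -κ - w ≠ 0 := fun h => by rw [h] at hm; simp at hm
  have n2 : κ - w ≠ 0 := fun h => by rw [h] at hp; simp at hp
  have hw2 : (((2 * Real.pi) ^ 2 * t ^ 2 : ℝ) + κ ^ 2 : ℂ) = -((-κ - w) * (κ - w)) := by
    have : w ^ 2 = -((2 * Real.pi) ^ 2 * t ^ 2 : ℝ) := by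
      rw [hw, mul_pow, Complex.I_sq]; push_cast; ring
    push_cast at this ⊢
    linear_combination this
  rw [hw2]
  simp only [Complex.ofReal_zero, mul_zero, Complex.exp_zero]
  field_simp
  ring

/-- The potential is radial, so a reflection moves `ξ` onto the first axis. The phase is then
constant on the planes orthogonal to that axis; integrating over them first leaves the Fourier
transform of `e^{-κ|s|}/(2κ)` on the line. -/
theorem fourier_yukawa {κ : ℂ} (hκ : 0 < κ.re) (ξ : R3) :
    𝓕 (yukawa κ) ξ = (((2 * Real.pi) ^ 2 * ‖ξ‖ ^ 2 : ℝ) + κ ^ 2 : ℂ)⁻¹ := by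
  set η : R3 := EuclideanSpace.single 0 ‖ξ‖ with hη
  have hnorm : ‖η‖ = ‖ξ‖ := by simp [hη]
  set F := (ℝ ∙ (η - ξ))ᗮ.reflection with hF
  have hFη : F η = ξ := Submodule.reflection_sub hnorm
  rw [Real.fourier_eq', ← F.measurePreserving.integral_comp F.toHomeomorph.measurableEmbedding]
  have h1 : ∀ v : R3, inner ℝ (F v) ξ = v 0 * ‖ξ‖ := by
    intro v
    rw [← hFη, F.inner_map_map, hη, EuclideanSpace.inner_single_right]
    simp [mul_comm]
  have h2 : ∀ v : R3, yukawa κ (F v) = yukawa κ v := by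
    intro v; simp only [yukawa, F.norm_map]
  simp only [h1, h2, smul_eq_mul]
  rw [← measurePreserving_cylinderEquiv.integral_comp cylinderEquiv.measurableEmbedding,
    Measure.volume_eq_prod, integral_prod]
  · simp only [cylinderEquiv_apply_zero]
    rw [← integral_exp_neg_abs_mul_exp hκ]
    refine integral_congr_ae ?_
    have : ∀ᵐ s : ℝ, s ≠ 0 := by simp [ae_iff]
    filter_upwards [this] with s hs
    rw [integral_const_mul, integral_yukawa_plane hκ hs]
  · have hi : Integrable (fun v : R3 => Complex.exp (((-2 * Real.pi * (v 0 * ‖ξ‖) : ℝ) : ℂ) * Complex.I)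
        * yukawa κ v) := by
      refine (integrable_yukawa hκ).bdd_mul (c := 1) ?_ ?_
      · exact Continuous.aestronglyMeasurable (by fun_prop)
      · exact Eventually.of_forall fun v => (Complex.norm_exp_ofReal_mul_I _).le
    exact (measurePreserving_cylinderEquiv.integrable_comp_emb
      cylinderEquiv.measurableEmbedding).2 hi

/-! ### The free resolvent on Schwartz functions -/

/-- The symbol `(4π²|ξ|² + κ²)⁻¹` of the resolvent of `-Δ` at `-κ²`. -/
def resolventSymbol (κ : ℂ) (ξ : R3) : ℂ := (((2 * Real.pi) ^ 2 * ‖ξ‖ ^ 2 : ℝ) + κ ^ 2 : ℂ)⁻¹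

/-- The resolvent of `-Δ` at `-κ²` on the Schwartz space. -/
def schwartzResolvent (κ : ℂ) : 𝓢(R3, ℂ) →L[ℂ] 𝓢(R3, ℂ) :=
  SchwartzMap.fourierMultiplierCLM ℂ (resolventSymbol κ)

theorem resolventSymbol_denom_ne_zero {κ : ℂ} (hκ : 0 < κ.re) (ξ : R3) :
    (((2 * Real.pi) ^ 2 * ‖ξ‖ ^ 2 : ℝ) + κ ^ 2 : ℂ) ≠ 0 := by
  intro h
  have := sq_re_le_norm_add_sq hκ (t := (2 * Real.pi) ^ 2 * ‖ξ‖ ^ 2) (by positivity)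
  rw [h, norm_zero] at this
  have : 0 < κ.re ^ 2 := by positivity
  linarith

theorem schwartz_laplacian_eq_multiplier (f : 𝓢(R3, ℂ)) :
    Δ f = (-(2 * Real.pi) ^ 2 : ℝ) • SchwartzMap.fourierMultiplierCLM ℂ
      (fun ξ : R3 => RCLike.ofReal (K := ℂ) (‖ξ‖ ^ 2)) f := by
  rw [SchwartzMap.laplacian_eq_fourierMultiplierCLM,
    SchwartzMap.fourierMultiplierCLM_ofReal ℂ (Function.hasTemperateGrowth_norm_sq R3)]

theorem schwartzResolvent_equation {κ : ℂ} (hκ : 0 < κ.re) (φ : 𝓢(R3, ℂ)) :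
    -Δ (schwartzResolvent κ φ) + κ ^ 2 • schwartzResolvent κ φ = φ := by
  have hm : (resolventSymbol κ).HasTemperateGrowth := hasTemperateGrowth_resolventSymbol hκ
  have hn : (fun ξ : R3 => RCLike.ofReal (K := ℂ) (‖ξ‖ ^ 2)).HasTemperateGrowth := by fun_prop
  rw [schwartz_laplacian_eq_multiplier, schwartzResolvent,
    SchwartzMap.fourierMultiplierCLM_fourierMultiplierCLM_apply hn hm,
    SchwartzMap.fourierMultiplierCLM_apply, SchwartzMap.fourierMultiplierCLM_apply,
    ← FourierTransform.fourierInv_smul, ← FourierTransform.fourierInv_smul,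
    ← FourierTransform.fourierInv_neg, ← FourierTransform.fourierInv_add]
  nth_rewrite 3 [← FourierTransform.fourierInv_fourier_eq (F := 𝓢(R3, ℂ)) φ]
  congr 1
  ext ξ
  simp only [add_apply, neg_apply, smul_apply,
    SchwartzMap.smulLeftCLM_apply_apply (hn.mul hm), SchwartzMap.smulLeftCLM_apply_apply hm,
    Pi.mul_apply, smul_eq_mul, resolventSymbol, Complex.real_smul]
  have hc : RCLike.ofReal (K := ℂ) (‖ξ‖ ^ 2) = ((‖ξ‖ ^ 2 : ℝ) : ℂ) := rfl
  rw [hc]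
  have h := resolventSymbol_denom_ne_zero hκ ξ
  push_cast at h ⊢
  linear_combination ((𝓕 φ : 𝓢(R3, ℂ)) ξ) * mul_inv_cancel₀ h

/-- Convolution theorem by duality: the Fourier transform is moved from `yukawa κ` onto `g`, the
transform of `φ` modulated by `x`, whose own transform is `y ↦ φ (x - y)`. -/
theorem schwartzResolvent_apply {κ : ℂ} (hκ : 0 < κ.re) (φ : 𝓢(R3, ℂ)) (x : R3) :
    schwartzResolvent κ φ x = ∫ y, yukawa κ (x - y) * φ y := by
  have hm : (resolventSymbol κ).HasTemperateGrowth := hasTemperateGrowth_resolventSymbol hκ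
  have hφ : Integrable (𝓕 φ : 𝓢(R3, ℂ)) := SchwartzMap.integrable _
  rw [schwartzResolvent, SchwartzMap.fourierMultiplierCLM_apply, SchwartzMap.fourierInv_coe,
    Real.fourierInv_eq']
  simp only [SchwartzMap.smulLeftCLM_apply_apply hm]
  set g : R3 → ℂ := fun ξ => Complex.exp (((2 * Real.pi * inner ℝ ξ x : ℝ) : ℂ) * Complex.I) *
    (𝓕 φ : 𝓢(R3, ℂ)) ξ with hg
  have hgi : Integrable g := by
    refine hφ.bdd_mul (c := 1) ?_ ?_
    · exact Continuous.aestronglyMeasurable (by fun_prop)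
    · exact Eventually.of_forall fun v => (Complex.norm_exp_ofReal_mul_I _).le
  have hsym := VectorFourier.integral_fourierIntegral_smul_eq_flip (L := innerₗ R3)
    (μ := volume) (ν := volume) Real.continuous_fourierChar continuous_inner
    (integrable_yukawa hκ) hgi
  have hl : ∀ ξ, VectorFourier.fourierIntegral Real.fourierChar volume (innerₗ R3) (yukawa κ) ξ
      = resolventSymbol κ ξ := fun ξ => fourier_yukawa hκ ξ
  have hr : ∀ y, VectorFourier.fourierIntegral Real.fourierChar volume (innerₗ R3).flip g y
      = φ (x - y) := by
    intro y
    have hinv : φ (x - y) = 𝓕⁻ (𝓕 φ : 𝓢(R3, ℂ)) (x - y) := by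
      rw [FourierTransform.fourierInv_fourier_eq]
    rw [hinv, SchwartzMap.fourierInv_coe, Real.fourierInv_eq', flip_innerₗ]
    change 𝓕 g y = _
    rw [Real.fourier_eq']
    refine integral_congr_ae (Eventually.of_forall fun ξ => ?_)
    simp only [hg, smul_eq_mul, ← mul_assoc, ← Complex.exp_add, inner_sub_right]
    congr 2
    push_cast
    ring
  simp only [hl, hr] at hsym
  calc _ = ∫ ξ, resolventSymbol κ ξ • g ξ := by
        refine integral_congr_ae (Eventually.of_forall fun ξ => ?_)
        simp only [hg, smul_eq_mul]; ring
    _ = ∫ y, yukawa κ y * φ (x - y) := hsym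
    _ = _ := by
        rw [← integral_sub_left_eq_self (fun y => yukawa κ y * φ (x - y)) volume x]
        simp

/-! ### Weighted estimates for convolution with the Yukawa potential -/

/-- The exponential weight `e^{-ε|x|}`. -/
def expWeight (ε : ℝ) (x : R3) : ℝ≥0∞ := ENNReal.ofReal (Real.exp (-ε * ‖x‖))

theorem measurable_expWeight (ε : ℝ) : Measurable (expWeight ε) := by
  unfold expWeight; fun_prop

theorem expWeight_ne_zero (ε : ℝ) (x : R3) : expWeight ε x ≠ 0 := by
  simp [expWeight, Real.exp_pos]

theorem expWeight_ne_top (ε : ℝ) (x : R3) : expWeight ε x ≠ ⊤ := ENNReal.ofReal_ne_top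

/-- The convolution of `h` with the Yukawa potential. -/
def yukawaConv (κ : ℂ) (h : R3 → ℂ) (x : R3) : ℂ := ∫ y, yukawa κ (x - y) * h y

/-- The triangle inequality `|y| ≤ |x - y| + |x|` transfers the weight from `x` to `y` at the price
of lowering the decay rate of the kernel by `ε`. -/
theorem norm_yukawa_mul_exp_le (κ : ℂ) {ε : ℝ} (hε : 0 ≤ ε) (x y : R3) :
    ‖yukawa κ (x - y)‖ * Real.exp (-ε * ‖x‖)
      ≤ ‖yukawa (κ - ε) (x - y)‖ * Real.exp (-ε * ‖y‖) := by
  rw [norm_yukawa, norm_yukawa, div_mul_eq_mul_div, div_mul_eq_mul_div, ← Real.exp_add,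
    ← Real.exp_add]
  refine div_le_div_of_nonneg_right (Real.exp_le_exp.2 ?_) (by positivity)
  have h : ‖y‖ ≤ ‖x - y‖ + ‖x‖ := by
    have := norm_sub_norm_le y x
    rw [norm_sub_rev] at this
    linarith
  simp only [Complex.sub_re, Complex.ofReal_re]
  nlinarith

theorem enorm_yukawa_mul_expWeight_le (κ : ℂ) {ε : ℝ} (hε : 0 ≤ ε) (x y : R3) :
    ‖yukawa κ (x - y)‖ₑ * expWeight ε x ≤ ‖yukawa (κ - ε) (x - y)‖ₑ * expWeight ε y := by
  rw [← ofReal_norm, ← ofReal_norm, expWeight, expWeight,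
    ← ENNReal.ofReal_mul (norm_nonneg _), ← ENNReal.ofReal_mul (norm_nonneg _)]
  exact ENNReal.ofReal_le_ofReal (norm_yukawa_mul_exp_le κ hε x y)

theorem aestronglyMeasurable_yukawa_mul_prod (κ : ℂ) {h : R3 → ℂ}
    (hh : AEStronglyMeasurable h (volume : Measure R3)) :
    AEStronglyMeasurable (fun z : R3 × R3 => yukawa κ (z.1 - z.2) * h z.2)
      ((volume : Measure R3).prod volume) :=
  ((measurable_yukawa κ).comp (measurable_fst.sub measurable_snd)).aestronglyMeasurable.mul
    hh.comp_snd

theorem aestronglyMeasurable_yukawaConv (κ : ℂ) {h : R3 → ℂ}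
    (hh : AEStronglyMeasurable h (volume : Measure R3)) :
    AEStronglyMeasurable (yukawaConv κ h) (volume : Measure R3) :=
  (aestronglyMeasurable_yukawa_mul_prod κ hh).integral_prod_right'

/-- Weighted Schur estimate for the Yukawa kernel. -/
theorem lintegral_lintegral_yukawa_le (κ : ℂ) {ε : ℝ} (hε : 0 ≤ ε) {V : R3 → ℝ≥0∞}
    (hV : AEMeasurable V) {h : R3 → ℂ} (hh : AEStronglyMeasurable h (volume : Measure R3)) {K : ℝ≥0∞}
    (hK : ∀ y, ∫⁻ x, ‖yukawa (κ - ε) (x - y)‖ₑ * V x ≤ K) :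
    ∫⁻ x, ∫⁻ y, ‖yukawa κ (x - y) * h y‖ₑ * (V x * expWeight ε x)
      ≤ K * ∫⁻ y, ‖h y‖ₑ * expWeight ε y := by
  have hm1 : AEMeasurable (fun x => V x * expWeight ε x) :=
    hV.mul (measurable_expWeight ε).aemeasurable
  have hm2 : AEMeasurable (fun y => ‖h y‖ₑ * expWeight ε y) :=
    hh.enorm.mul (measurable_expWeight ε).aemeasurable
  -- By Tonelli the `x`-integral is done first: for fixed `y`, once the weight has moved to `y`, it
  -- is exactly what `hK` controls.
  rw [lintegral_lintegral_swap ((aestronglyMeasurable_yukawa_mul_prod κ hh).enorm.mul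
    hm1.comp_fst), ← lintegral_const_mul'' _ hm2]
  refine lintegral_mono fun y => ?_
  calc ∫⁻ x, ‖yukawa κ (x - y) * h y‖ₑ * (V x * expWeight ε x)
      ≤ ∫⁻ x, (‖yukawa (κ - ε) (x - y)‖ₑ * V x) * (‖h y‖ₑ * expWeight ε y) := by
        refine lintegral_mono fun x => ?_
        rw [enorm_mul]
        calc _ = (‖yukawa κ (x - y)‖ₑ * expWeight ε x) * (V x * ‖h y‖ₑ) := by ring
          _ ≤ (‖yukawa (κ - ε) (x - y)‖ₑ * expWeight ε y) * (V x * ‖h y‖ₑ) :=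
            mul_le_mul_left (enorm_yukawa_mul_expWeight_le κ hε x y) _
          _ = _ := by ring
    _ = (∫⁻ x, ‖yukawa (κ - ε) (x - y)‖ₑ * V x) * (‖h y‖ₑ * expWeight ε y) := by
        refine lintegral_mul_const'' _ (AEMeasurable.mul ?_ hV)
        exact ((measurable_yukawa _).comp (measurable_id.sub_const y)).enorm.aemeasurable
    _ ≤ _ := mul_le_mul_left (hK y) _

theorem lintegral_enorm_yukawaConv_le (κ : ℂ) {ε : ℝ} (hε : 0 ≤ ε) {V : R3 → ℝ≥0∞}
    (hV : AEMeasurable V) {h : R3 → ℂ} (hh : AEStronglyMeasurable h (volume : Measure R3)) {K : ℝ≥0∞}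
    (hK : ∀ y, ∫⁻ x, ‖yukawa (κ - ε) (x - y)‖ₑ * V x ≤ K) :
    ∫⁻ x, ‖yukawaConv κ h x‖ₑ * (V x * expWeight ε x) ≤ K * ∫⁻ y, ‖h y‖ₑ * expWeight ε y := by
  refine le_trans (lintegral_mono fun x => ?_) (lintegral_lintegral_yukawa_le κ hε hV hh hK)
  have hx : AEMeasurable (fun y => ‖yukawa κ (x - y) * h y‖ₑ) :=
    (((measurable_yukawa κ).comp (measurable_const.sub measurable_id)).aestronglyMeasurable.mul
      hh).enorm
  rw [lintegral_mul_const'' _ hx]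
  exact mul_le_mul_left (enorm_integral_le_lintegral_enorm _) _

theorem lintegral_enorm_yukawa_translate (κ : ℂ) (y : R3) :
    ∫⁻ x, ‖yukawa κ (x - y)‖ₑ * 1 ≤ ∫⁻ x, ‖yukawa κ x‖ₑ := by
  simp only [mul_one]
  exact (lintegral_sub_right_eq_self (fun x => ‖yukawa κ x‖ₑ) y).le

/-- `e^{-ε|x|} h` is integrable. -/
def ExpIntegrable (ε : ℝ) (h : R3 → ℂ) : Prop :=
  Integrable (fun x => Real.exp (-ε * ‖x‖) • h x) (volume : Measure R3)

theorem aestronglyMeasurable_of_exp_smul {ε : ℝ} {h : R3 → ℂ}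
    (hh : AEStronglyMeasurable (fun x => Real.exp (-ε * ‖x‖) • h x) (volume : Measure R3)) :
    AEStronglyMeasurable h (volume : Measure R3) := by
  have hc : Continuous fun x : R3 => Real.exp (ε * ‖x‖) := by fun_prop
  have h2 := hc.aestronglyMeasurable (μ := (volume : Measure R3)) |>.smul hh
  refine h2.congr (Eventually.of_forall fun x => ?_)
  simp only [Pi.smul_apply', smul_smul, ← Real.exp_add]
  simp

theorem enorm_exp_smul (ε : ℝ) (h : R3 → ℂ) (x : R3) :
    ‖Real.exp (-ε * ‖x‖) • h x‖ₑ = ‖h x‖ₑ * expWeight ε x := by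
  rw [enorm_smul, mul_comm, expWeight, Real.enorm_of_nonneg (Real.exp_pos _).le]

theorem expIntegrable_iff {ε : ℝ} {h : R3 → ℂ} :
    ExpIntegrable ε h ↔ AEStronglyMeasurable h (volume : Measure R3) ∧
      ∫⁻ x, ‖h x‖ₑ * expWeight ε x < ⊤ := by
  have hc : Continuous fun x : R3 => Real.exp (-ε * ‖x‖) := by fun_prop
  simp only [← enorm_exp_smul]
  exact ⟨fun hi => ⟨aestronglyMeasurable_of_exp_smul hi.1, hi.2⟩,
    fun hi => ⟨hc.aestronglyMeasurable.smul hi.1, hi.2⟩⟩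

theorem ExpIntegrable.aestronglyMeasurable {ε : ℝ} {h : R3 → ℂ} (hh : ExpIntegrable ε h) :
    AEStronglyMeasurable h (volume : Measure R3) := (expIntegrable_iff.1 hh).1

theorem ExpIntegrable.sub {ε : ℝ} {h k : R3 → ℂ} (hh : ExpIntegrable ε h)
    (hk : ExpIntegrable ε k) : ExpIntegrable ε (fun x => h x - k x) := by
  have := Integrable.sub hh hk
  refine this.congr (Eventually.of_forall fun x => ?_)
  simp only [Pi.sub_apply, smul_sub]

theorem ExpIntegrable.congr {ε : ℝ} {h k : R3 → ℂ} (hh : ExpIntegrable ε h)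
    (hk : h =ᵐ[volume] k) : ExpIntegrable ε k := by
  refine Integrable.congr hh ?_
  filter_upwards [hk] with x hx
  rw [hx]

theorem ExpIntegrable.locallyIntegrable {ε : ℝ} {h : R3 → ℂ} (hh : ExpIntegrable ε h) :
    LocallyIntegrable h (volume : Measure R3) := by
  have hc : Continuous fun x : R3 => Real.exp (ε * ‖x‖) := by fun_prop
  rw [locallyIntegrable_iff]
  intro k hk
  refine ((Integrable.integrableOn hh).continuousOn_smul hc.continuousOn hk).congr
    (Eventually.of_forall fun x => ?_)
  simp only [smul_smul, ← Real.exp_add]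
  simp

theorem ExpIntegrable.integrable_mul {ε : ℝ} {h ψ : R3 → ℂ} (hh : ExpIntegrable ε h)
    (hψ : AEStronglyMeasurable ψ (volume : Measure R3)) {C : ℝ}
    (hC : ∀ x, ‖ψ x‖ ≤ C * Real.exp (-ε * ‖x‖)) : Integrable (fun x => h x * ψ x) := by
  refine Integrable.mono' (hh.norm.const_mul C) (hh.aestronglyMeasurable.mul hψ)
    (Eventually.of_forall fun x => ?_)
  rw [norm_mul, norm_smul, Real.norm_of_nonneg (Real.exp_pos _).le]
  calc _ ≤ ‖h x‖ * (C * Real.exp (-ε * ‖x‖)) := by gcongr; exact hC x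
    _ = _ := by ring

theorem ExpIntegrable.ae_integrable_yukawa {κ : ℂ} {ε : ℝ} (hε : 0 ≤ ε) (hκ : ε < κ.re)
    {h : R3 → ℂ} (hh : ExpIntegrable ε h) :
    ∀ᵐ x, Integrable (fun y => yukawa κ (x - y) * h y) := by
  obtain ⟨hm, hf⟩ := expIntegrable_iff.1 hh
  have hfin := lintegral_lintegral_yukawa_le κ hε (V := fun _ => 1) aemeasurable_const hm
    (lintegral_enorm_yukawa_translate (κ - ε))
  have hG : ∫⁻ x, ‖yukawa (κ - ε) x‖ₑ < ⊤ := (integrable_yukawa (by simpa using hκ)).2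
  have hlt := lt_of_le_of_lt hfin (ENNReal.mul_lt_top hG hf)
  have hmeas : AEMeasurable (fun x => ∫⁻ y, ‖yukawa κ (x - y) * h y‖ₑ * (1 * expWeight ε x)) :=
    AEMeasurable.lintegral_prod_right' (f := fun z : R3 × R3 =>
      ‖yukawa κ (z.1 - z.2) * h z.2‖ₑ * (1 * expWeight ε z.1))
      ((aestronglyMeasurable_yukawa_mul_prod κ hm).enorm.mul
        (aemeasurable_const.mul ((measurable_expWeight ε).comp measurable_fst).aemeasurable))
  filter_upwards [ae_lt_top' hmeas hlt.ne] with x hx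
  have hx' : AEStronglyMeasurable (fun y => yukawa κ (x - y) * h y) volume :=
    ((measurable_yukawa κ).comp (measurable_const.sub measurable_id)).aestronglyMeasurable.mul hm
  refine ⟨hx', ?_⟩
  rw [lintegral_mul_const'' _ hx'.enorm, one_mul] at hx
  exact ENNReal.lt_top_of_mul_ne_top_left hx.ne (expWeight_ne_zero ε x)

theorem yukawaConv_sub_ae {κ : ℂ} {ε : ℝ} (hε : 0 ≤ ε) (hκ : ε < κ.re)
    {h k : R3 → ℂ} (hh : ExpIntegrable ε h) (hk : ExpIntegrable ε k) :
    ∀ᵐ x, yukawaConv κ (fun y => h y - k y) x = yukawaConv κ h x - yukawaConv κ k x := by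
  filter_upwards [hh.ae_integrable_yukawa hε hκ, hk.ae_integrable_yukawa hε hκ] with x h1 h2
  simp only [yukawaConv, mul_sub]
  exact integral_sub h1 h2

theorem yukawaConv_congr (κ : ℂ) {h k : R3 → ℂ} (hk : h =ᵐ[volume] k) :
    yukawaConv κ h = yukawaConv κ k := by
  ext x
  refine integral_congr_ae ?_
  filter_upwards [hk] with y hy
  rw [hy]

theorem ExpIntegrable.yukawaConv {κ : ℂ} {ε : ℝ} (hε : 0 ≤ ε) (hκ : ε < κ.re)
    {h : R3 → ℂ} (hh : ExpIntegrable ε h) : ExpIntegrable ε (yukawaConv κ h) := by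
  obtain ⟨hm, hf⟩ := expIntegrable_iff.1 hh
  refine expIntegrable_iff.2 ⟨aestronglyMeasurable_yukawaConv κ hm, ?_⟩
  have := lintegral_enorm_yukawaConv_le κ hε (V := fun _ => 1) aemeasurable_const hm
    (lintegral_enorm_yukawa_translate (κ - ε))
  simp only [one_mul] at this
  have hG : ∫⁻ x, ‖yukawa (κ - ε) x‖ₑ < ⊤ := (integrable_yukawa (by simpa using hκ)).2
  exact lt_of_le_of_lt this (ENNReal.mul_lt_top hG hf)

/-- The class of functions decaying like `e^{-ε|x|}` is stable under convolution, so resolvents of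
admissible test functions are again admissible. -/
theorem norm_yukawaConv_le {κ : ℂ} {ε : ℝ} (hε : 0 ≤ ε) (hκ : ε < κ.re) {ψ : R3 → ℂ} {C : ℝ}
    (hC : ∀ x, ‖ψ x‖ ≤ C * Real.exp (-ε * ‖x‖)) (x : R3) :
    ‖yukawaConv κ ψ x‖ ≤ (C * ∫ y, ‖yukawa (κ - ε) y‖) * Real.exp (-ε * ‖x‖) := by
  have hC0 : 0 ≤ C := by
    have := (norm_nonneg _).trans (hC 0)
    simpa using this
  have hG : Integrable (yukawa (κ - ε)) := integrable_yukawa (by simpa using hκ)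
  have hb : ∀ y, ‖yukawa κ (x - y) * ψ y‖ ≤ (C * Real.exp (-ε * ‖x‖)) * ‖yukawa (κ - ε) (x - y)‖ := by
    intro y
    have h1 := norm_yukawa_mul_exp_le κ hε y x
    rw [← neg_sub x y, yukawa_neg, yukawa_neg] at h1
    rw [norm_mul]
    calc _ ≤ ‖yukawa κ (x - y)‖ * (C * Real.exp (-ε * ‖y‖)) := by gcongr; exact hC y
      _ = C * (‖yukawa κ (x - y)‖ * Real.exp (-ε * ‖y‖)) := by ring
      _ ≤ C * (‖yukawa (κ - ε) (x - y)‖ * Real.exp (-ε * ‖x‖)) := by gcongr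
      _ = _ := by ring
  refine (norm_integral_le_of_norm_le ((hG.norm.comp_sub_left x).const_mul _)
    (Eventually.of_forall hb)).trans (le_of_eq ?_)
  rw [integral_const_mul, integral_sub_left_eq_self (fun y => ‖yukawa (κ - ε) y‖) volume x]
  ring

/-- The kernel is even, so convolution is symmetric for the bilinear pairing. The decay of `ψ`
compensates the weight on `h` and makes the double integral absolutely convergent for Fubini. -/
theorem integral_yukawaConv_mul {κ : ℂ} {ε : ℝ} (hε : 0 ≤ ε) (hκ : ε < κ.re) {h ψ : R3 → ℂ}
    (hh : ExpIntegrable ε h) (hψ : AEStronglyMeasurable ψ (volume : Measure R3)) {C : ℝ}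
    (hC : ∀ x, ‖ψ x‖ ≤ C * Real.exp (-ε * ‖x‖)) :
    ∫ x, yukawaConv κ h x * ψ x = ∫ y, h y * yukawaConv κ ψ y := by
  obtain ⟨hm, hf⟩ := expIntegrable_iff.1 hh
  have hint : Integrable (Function.uncurry fun x y => yukawa κ (x - y) * h y * ψ x)
      ((volume : Measure R3).prod volume) := by
    have hmeas := (aestronglyMeasurable_yukawa_mul_prod κ hm).mul
      (hψ.comp_fst (ν := (volume : Measure R3)))
    refine ⟨hmeas, ?_⟩
    have hG : ∫⁻ x, ‖yukawa (κ - ε) x‖ₑ < ⊤ := (integrable_yukawa (by simpa using hκ)).2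
    have hle := lintegral_lintegral_yukawa_le κ hε (V := fun _ => ENNReal.ofReal C)
      aemeasurable_const hm (K := (∫⁻ x, ‖yukawa (κ - ε) x‖ₑ) * ENNReal.ofReal C) (fun y => by
        rw [lintegral_mul_const' _ _ ENNReal.ofReal_ne_top]
        refine mul_le_mul_left ?_ _
        simpa using lintegral_enorm_yukawa_translate (κ - ε) y)
    refine lt_of_le_of_lt ?_ (lt_of_le_of_lt hle (ENNReal.mul_lt_top
      (ENNReal.mul_lt_top hG ENNReal.ofReal_lt_top) hf))
    refine (lintegral_prod_le _).trans (lintegral_mono fun x => lintegral_mono fun y => ?_)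
    simp only [Function.uncurry, enorm_mul]
    refine mul_le_mul_right ?_ _
    have hC0 : 0 ≤ C := by simpa using (norm_nonneg _).trans (hC 0)
    rw [expWeight, ← ENNReal.ofReal_mul hC0, ← ofReal_norm]
    exact ENNReal.ofReal_le_ofReal (hC x)
  calc ∫ x, yukawaConv κ h x * ψ x = ∫ x, ∫ y, yukawa κ (x - y) * h y * ψ x := by
        simp only [yukawaConv, integral_mul_const]
    _ = ∫ y, ∫ x, yukawa κ (x - y) * h y * ψ x := integral_integral_swap hint
    _ = ∫ y, h y * yukawaConv κ ψ y := by
        refine integral_congr_ae (Eventually.of_forall fun y => ?_)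
        simp only [yukawaConv, ← integral_const_mul]
        refine integral_congr_ae (Eventually.of_forall fun x => ?_)
        simp only
        rw [← neg_sub x y, yukawa_neg]
        ring

/-! ### Stummel classes and weighted Lebesgue spaces -/

theorem integrable_exp_neg_mul_norm {c : ℝ} (hc : 0 < c) :
    Integrable (fun x : R3 => Real.exp (-c * ‖x‖)) := by
  rw [integrable_fun_norm_addHaar (volume : Measure R3) (f := fun y => Real.exp (-c * y)), finrank_R3]
  have h := integrableOn_rpow_mul_exp_neg_mul_rpow (s := 2) (p := 1) (b := c)
    (by norm_num) one_pos hc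
  refine h.congr_fun (fun y _ => ?_) measurableSet_Ioi
  simp

theorem lintegral_expWeight_lt_top {c : ℝ} (hc : 0 < c) : ∫⁻ x, expWeight c x < ⊤ := by
  have := (integrable_exp_neg_mul_norm hc).2
  refine lt_of_le_of_lt (lintegral_mono fun x => ?_) this
  rw [expWeight, Real.enorm_of_nonneg (Real.exp_pos _).le]

/-- A function of Stummel class is locally uniformly integrable to the power `s`, hence integrable
against an exponentially decaying weight. -/
theorem lintegral_rpow_mul_expWeight_lt_top {ν s : ℝ} {u : R3 → ℂ}
    (hu : AEStronglyMeasurable u (volume : Measure R3)) (hM : stummelM ν s u < ⊤) {ε : ℝ}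
    (hε : 0 < ε) : ∫⁻ y, ‖u y‖ₑ ^ s * expWeight ε y < ⊤ := by
  set k : R3 → ℝ≥0∞ := (Metric.ball (0 : R3) 1).indicator
    (fun v => ENNReal.ofReal (‖v‖ ^ (ν - 3))) with hk
  have hkm : Measurable k := by
    refine Measurable.indicator ?_ Metric.isOpen_ball.measurableSet
    fun_prop
  have hk0 : ∫⁻ x, k x ≠ 0 := by
    refine ((lintegral_pos_iff_support hkm).2 ?_).ne'
    have hsub : Metric.ball (0 : R3) 1 \ {0} ⊆ Function.support k := by
      rintro v ⟨hv, hv0⟩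
      have hv1 : 0 < ‖v‖ := norm_pos_iff.2 hv0
      rw [Function.mem_support, hk, indicator_of_mem hv]
      simpa using Real.rpow_pos_of_pos hv1 _
    refine lt_of_lt_of_le ?_ (measure_mono hsub)
    rw [measure_sdiff_null (measure_singleton 0)]
    exact Metric.measure_ball_pos _ _ one_pos
  have hind : ∀ x y, (Metric.ball x 1).indicator (fun y => ‖u y‖ₑ ^ s *
      ENNReal.ofReal (‖x - y‖ ^ (ν - 3))) y = ‖u y‖ₑ ^ s * k (x - y) := by
    intro x y
    have : y ∈ Metric.ball x 1 ↔ x - y ∈ Metric.ball (0 : R3) 1 := by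
      rw [mem_ball_iff_norm', mem_ball_zero_iff]
    by_cases h : y ∈ Metric.ball x 1
    · rw [indicator_of_mem h, hk, indicator_of_mem (this.1 h)]
    · rw [indicator_of_notMem h, hk, indicator_of_notMem (fun h' => h (this.2 h')), mul_zero]
  have hum : AEMeasurable (fun y => ‖u y‖ₑ ^ s) := hu.enorm.pow_const s
  -- Average the Stummel bound over its centre `x` against the integrable weight.
  have h1 : ∫⁻ x, ∫⁻ y, (‖u y‖ₑ ^ s * k (x - y)) * expWeight ε x
      ≤ stummelM ν s u * ∫⁻ x, expWeight ε x := by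
    rw [← lintegral_const_mul _ (measurable_expWeight ε)]
    refine lintegral_mono fun x => ?_
    rw [lintegral_mul_const' _ _ (expWeight_ne_top ε x)]
    refine mul_le_mul_left ?_ _
    simp only [← hind]
    rw [lintegral_indicator Metric.isOpen_ball.measurableSet]
    exact le_iSup (fun x : R3 => ∫⁻ y in Metric.ball x 1,
      ‖u y‖ₑ ^ s * ENNReal.ofReal (‖x - y‖ ^ (ν - 3))) x
  rw [lintegral_lintegral_swap] at h1
  swap
  · exact (hum.comp_snd.mul (hkm.comp (measurable_fst.sub measurable_snd)).aemeasurable).mul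
      ((measurable_expWeight ε).comp measurable_fst).aemeasurable
  -- Where `k (x - y)` does not vanish, `|x| < |y| + 1`, so the weight passes from `x` to `y` with
  -- the loss `e^{-ε}`. After that the `x`-integral is a translate of `∫ k`, which need only be
  -- nonzero to be divided out.
  have hwt : ∀ x y, ENNReal.ofReal (Real.exp (-ε)) * expWeight ε y * k (x - y)
      ≤ k (x - y) * expWeight ε x := by
    intro x y
    by_cases h : x - y ∈ Metric.ball (0 : R3) 1
    · rw [mul_comm]
      refine mul_le_mul_right ?_ _
      rw [expWeight, expWeight, ← ENNReal.ofReal_mul (Real.exp_pos _).le, ← Real.exp_add]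
      refine ENNReal.ofReal_le_ofReal (Real.exp_le_exp.2 ?_)
      rw [mem_ball_zero_iff] at h
      have := norm_sub_norm_le x y
      nlinarith
    · rw [hk, indicator_of_notMem h]; simp
  have h2 : (∫⁻ y, ‖u y‖ₑ ^ s * expWeight ε y) * (ENNReal.ofReal (Real.exp (-ε)) * ∫⁻ x, k x)
      ≤ stummelM ν s u * ∫⁻ x, expWeight ε x := by
    have hum' : AEMeasurable (fun y => ‖u y‖ₑ ^ s * expWeight ε y) :=
      hum.mul (measurable_expWeight ε).aemeasurable
    rw [← lintegral_mul_const'' _ hum']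
    refine le_trans (lintegral_mono fun y => ?_) h1
    calc _ = (‖u y‖ₑ ^ s * (ENNReal.ofReal (Real.exp (-ε)) * expWeight ε y)) *
          ∫⁻ x, k (x - y) := by
          rw [lintegral_sub_right_eq_self k y]; ring
      _ = ∫⁻ x, (‖u y‖ₑ ^ s * (ENNReal.ofReal (Real.exp (-ε)) * expWeight ε y)) * k (x - y) :=
          (lintegral_const_mul _ (hkm.comp (measurable_id.sub_const y))).symm
      _ ≤ _ := by
          refine lintegral_mono fun x => ?_
          have := hwt x y
          simp only [mul_assoc] at this ⊢
          exact mul_le_mul_right this _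
  have h3 := lt_of_le_of_lt h2 (ENNReal.mul_lt_top hM (lintegral_expWeight_lt_top hε))
  exact ENNReal.lt_top_of_mul_ne_top_left h3.ne (mul_ne_zero (by simp [Real.exp_pos]) hk0)

theorem memLp_exp_smul_of_lintegral {s : ℝ} (hs : 0 < s) {u : R3 → ℂ}
    (hu : AEStronglyMeasurable u (volume : Measure R3)) {ε : ℝ}
    (h : ∫⁻ y, ‖u y‖ₑ ^ s * expWeight (s * ε) y < ⊤) :
    MemLp (fun x => Real.exp (-ε * ‖x‖) • u x) (ENNReal.ofReal s) volume := by
  have hc : Continuous fun x : R3 => Real.exp (-ε * ‖x‖) := by fun_prop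
  refine ⟨hc.aestronglyMeasurable.smul hu, ?_⟩
  rw [eLpNorm_lt_top_iff_lintegral_rpow_enorm_lt_top (by simpa using hs) ENNReal.ofReal_ne_top,
    ENNReal.toReal_ofReal hs.le]
  refine lt_of_le_of_lt (lintegral_mono fun x => ?_) h
  rw [enorm_exp_smul, ENNReal.mul_rpow_of_nonneg _ _ hs.le]
  refine mul_le_mul_right ?_ _
  rw [expWeight, expWeight, ENNReal.ofReal_rpow_of_nonneg (Real.exp_pos _).le hs.le, ← Real.exp_mul]
  refine ENNReal.ofReal_le_ofReal (Real.exp_le_exp.2 (le_of_eq ?_))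
  ring

theorem IsStummel.memLp_exp_smul {s : ℝ} (hs : 0 < s) {u : R3 → ℂ} (hu : IsStummel s u) {ε : ℝ}
    (hε : 0 < ε) : MemLp (fun x => Real.exp (-ε * ‖x‖) • u x) (ENNReal.ofReal s) volume := by
  obtain ⟨hm, ν, -, -, hM⟩ := hu
  exact memLp_exp_smul_of_lintegral hs hm
    (lintegral_rpow_mul_expWeight_lt_top hm hM (mul_pos hs hε))

theorem memLp_exp_smul_one {s : ℝ} (hs : 0 < s) {ε : ℝ} (hε : 0 < ε) :
    MemLp (fun x : R3 => Real.exp (-ε * ‖x‖) • (1 : ℂ)) (ENNReal.ofReal s) volume := by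
  refine memLp_exp_smul_of_lintegral (u := fun _ => 1) hs aestronglyMeasurable_const ?_
  simpa using lintegral_expWeight_lt_top (mul_pos hs hε)

theorem holderConjugate_conjExponent {p : ℝ≥0∞} (hp1 : 1 < p) (hp2 : p < ⊤) :
    ENNReal.HolderConjugate p (ENNReal.ofReal p.toReal.conjExponent) := by
  have h1 : 1 < p.toReal := by
    rwa [← ENNReal.toReal_one, ENNReal.toReal_lt_toReal ENNReal.one_ne_top hp2.ne]
  have h := (Real.HolderConjugate.conjExponent h1).ennrealOfReal
  rwa [ENNReal.ofReal_toReal hp2.ne] at h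

theorem conjExponent_pos {p : ℝ≥0∞} (hp1 : 1 < p) (hp2 : p < ⊤) :
    0 < p.toReal.conjExponent := by
  have h1 : 1 < p.toReal := by
    rwa [← ENNReal.toReal_one, ENNReal.toReal_lt_toReal ENNReal.one_ne_top hp2.ne]
  exact (Real.HolderConjugate.conjExponent h1).symm.pos

theorem lintegral_enorm_mul_expWeight_le {p p' : ℝ≥0∞} [hpp : ENNReal.HolderConjugate p p'] {ε : ℝ}
    {a f : R3 → ℂ} (ha : MemLp (fun x => Real.exp (-ε * ‖x‖) • a x) p' volume)
    (hf : MemLp f p volume) :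
    ∫⁻ x, ‖a x * f x‖ₑ * expWeight ε x
      ≤ eLpNorm (fun x => Real.exp (-ε * ‖x‖) • a x) p' volume * eLpNorm f p volume := by
  have : ENNReal.HolderTriple p' p 1 := hpp.symm
  have h := eLpNorm_smul_le_mul_eLpNorm (p := p') (q := p) (r := 1) hf.1 ha.1
  refine le_trans (le_of_eq ?_) h
  rw [eLpNorm_one_eq_lintegral_enorm]
  refine lintegral_congr fun x => ?_
  simp only [Pi.smul_apply', smul_eq_mul, enorm_mul, enorm_exp_smul]
  ring

theorem expIntegrable_mul {p p' : ℝ≥0∞} [hpp : ENNReal.HolderConjugate p p'] {ε : ℝ}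
    {a f : R3 → ℂ} (ha : MemLp (fun x => Real.exp (-ε * ‖x‖) • a x) p' volume)
    (hf : MemLp f p volume) : ExpIntegrable ε (fun x => a x * f x) :=
  expIntegrable_iff.2 ⟨(aestronglyMeasurable_of_exp_smul ha.1).mul hf.1,
    lt_of_le_of_lt (lintegral_enorm_mul_expWeight_le (p := p) ha hf) (ENNReal.mul_lt_top ha.2 hf.2)⟩

/-! ### Resolvent equations in integral form -/

theorem schwartzResolvent_eq_yukawaConv {κ : ℂ} (hκ : 0 < κ.re) (φ : 𝓢(R3, ℂ)) :
    (schwartzResolvent κ φ : R3 → ℂ) = yukawaConv κ φ :=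
  funext fun x => schwartzResolvent_apply hκ φ x

/-- The first resolvent identity, which on the Fourier side is a partial fraction identity between
the two symbols. -/
theorem schwartzResolvent_sub {κ μ : ℂ} (hκ : 0 < κ.re) (hμ : 0 < μ.re) (φ : 𝓢(R3, ℂ)) :
    schwartzResolvent μ φ - schwartzResolvent κ φ
      = (κ ^ 2 - μ ^ 2) • schwartzResolvent κ (schwartzResolvent μ φ) := by
  have hm : (resolventSymbol κ).HasTemperateGrowth := hasTemperateGrowth_resolventSymbol hκ
  have hn : (resolventSymbol μ).HasTemperateGrowth := hasTemperateGrowth_resolventSymbol hμ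
  rw [schwartzResolvent, schwartzResolvent,
    SchwartzMap.fourierMultiplierCLM_fourierMultiplierCLM_apply hm hn,
    SchwartzMap.fourierMultiplierCLM_apply, SchwartzMap.fourierMultiplierCLM_apply,
    SchwartzMap.fourierMultiplierCLM_apply, ← FourierTransform.fourierInv_smul,
    sub_eq_add_neg, ← FourierTransform.fourierInv_neg, ← FourierTransform.fourierInv_add]
  congr 1
  ext ξ
  simp only [add_apply, neg_apply, smul_apply, SchwartzMap.smulLeftCLM_apply_apply (hm.mul hn),
    SchwartzMap.smulLeftCLM_apply_apply hm, SchwartzMap.smulLeftCLM_apply_apply hn,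
    Pi.mul_apply, smul_eq_mul, resolventSymbol]
  have h1 := mul_inv_cancel₀ (resolventSymbol_denom_ne_zero hκ ξ)
  have h2 := mul_inv_cancel₀ (resolventSymbol_denom_ne_zero hμ ξ)
  set A := (((2 * Real.pi) ^ 2 * ‖ξ‖ ^ 2 : ℝ) + κ ^ 2 : ℂ)⁻¹
  set B := (((2 * Real.pi) ^ 2 * ‖ξ‖ ^ 2 : ℝ) + μ ^ 2 : ℂ)⁻¹
  generalize (FourierTransform.fourier φ) ξ = F
  linear_combination (-B * F) * h1 + A * F * h2

/-- A test function, as a Schwartz function with values in `ℂ`. -/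
def testSchwartz (g : R3 → ℝ) (hg : ContDiff ℝ (⊤ : ℕ∞) g) (hs : HasCompactSupport g) : 𝓢(R3, ℂ) :=
  HasCompactSupport.toSchwartzMap (f := fun x => (g x : ℂ)) (hs.comp_left Complex.ofReal_zero)
    (Complex.ofRealCLM.contDiff.comp hg)

theorem testSchwartz_apply (g : R3 → ℝ) (hg : ContDiff ℝ (⊤ : ℕ∞) g) (hs : HasCompactSupport g)
    (x : R3) : testSchwartz g hg hs x = (g x : ℂ) := rfl

theorem exists_testSchwartz_bound (g : R3 → ℝ) (hg : ContDiff ℝ (⊤ : ℕ∞) g)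
    (hs : HasCompactSupport g) (ε : ℝ) :
    ∃ C, ∀ x, ‖testSchwartz g hg hs x‖ ≤ C * Real.exp (-ε * ‖x‖) := by
  have hc : Continuous fun x => Real.exp (ε * ‖x‖) * g x := by
    have := hg.continuous
    fun_prop
  have hsc : HasCompactSupport fun x => Real.exp (ε * ‖x‖) * g x := hs.mul_left
  obtain ⟨C, hC⟩ := hc.bounded_above_of_compact_support hsc
  refine ⟨C, fun x => ?_⟩
  have := hC x
  rw [norm_mul, Real.norm_of_nonneg (Real.exp_pos _).le] at this
  rw [testSchwartz_apply, Complex.norm_real]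
  calc ‖g x‖ = (Real.exp (ε * ‖x‖) * ‖g x‖) * Real.exp (-ε * ‖x‖) := by
        rw [mul_right_comm, ← Real.exp_add]; simp
    _ ≤ _ := by gcongr

theorem ae_eq_of_forall_testSchwartz {ε : ℝ} {u v : R3 → ℂ} (hu : ExpIntegrable ε u)
    (hv : ExpIntegrable ε v) (h : ∀ φ : 𝓢(R3, ℂ), (∃ C, ∀ x, ‖φ x‖ ≤ C * Real.exp (-ε * ‖x‖)) →
      ∫ x, u x * φ x = ∫ x, v x * φ x) : u =ᵐ[volume] v := by
  refine ae_eq_of_integral_contDiff_smul_eq hu.locallyIntegrable hv.locallyIntegrable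
    fun g hg hs => ?_
  have := h (testSchwartz g hg hs) (exists_testSchwartz_bound g hg hs ε)
  simp only [testSchwartz_apply] at this
  simpa only [Complex.real_smul, mul_comm] using this

/-- Lebesgue functions that solve the resolvent equation in the sense of distributions are Yukawa
potentials. -/
theorem ae_eq_yukawaConv_of_resolvent_equation {p : ℝ≥0∞} [Fact (1 ≤ p)] (hp1 : 1 < p)
    (hp2 : p < ⊤) {κ : ℂ} (hκ : 0 < κ.re) {v f : LpR3 p}
    (h : (f : 𝓢'(R3, ℂ)) = -Δ (v : 𝓢'(R3, ℂ)) + κ ^ 2 • (v : 𝓢'(R3, ℂ))) :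
    (v : R3 → ℂ) =ᵐ[volume] yukawaConv κ f := by
  have := holderConjugate_conjExponent hp1 hp2
  set ε := κ.re / 2 with hε
  have hε0 : 0 < ε := by positivity
  have hεκ : ε < κ.re := by linarith
  -- The constant 1 lies in the weighted `L_{p'}`, so Hölder puts every `L_p` function into the
  -- weighted `L_1`.
  have hone := memLp_exp_smul_one (conjExponent_pos hp1 hp2) hε0
  have hexp : ∀ w : LpR3 p, ExpIntegrable ε w := fun w => by
    simpa only [one_mul] using expIntegrable_mul (p := p) hone (Lp.memLp w)
  refine ae_eq_of_forall_testSchwartz (hexp v) ((hexp f).yukawaConv hε0.le hεκ) ?_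
  rintro φ ⟨C, hC⟩
  rw [integral_yukawaConv_mul hε0.le hεκ (hexp f) φ.continuous.aestronglyMeasurable hC,
    ← schwartzResolvent_eq_yukawaConv hκ]
  set ψ := schwartzResolvent κ φ with hψ
  -- Test the equation with the free resolvent of `φ`; moving the differential operator onto `ψ`
  -- returns `φ`.
  have h1 : (f : 𝓢'(R3, ℂ)) ψ = (v : 𝓢'(R3, ℂ)) φ := by
    rw [h]
    change -(Δ (v : 𝓢'(R3, ℂ)) ψ) + κ ^ 2 • ((v : 𝓢'(R3, ℂ)) ψ) = _
    rw [laplacian_apply_apply, ← map_neg, ← map_smul, ← map_add, hψ, schwartzResolvent_equation hκ]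
  rw [Lp.toTemperedDistribution_apply, Lp.toTemperedDistribution_apply] at h1
  simpa only [smul_eq_mul, mul_comm] using h1.symm

/-- Change of the spectral parameter in a resolvent equation, in integral form. -/
theorem ae_eq_neg_yukawaConv {κ μ : ℂ} {ε : ℝ} (hε : 0 ≤ ε) (hκ : ε < κ.re) (hμ : ε < μ.re)
    {u g : R3 → ℂ} (hu : ExpIntegrable ε u) (hg : ExpIntegrable ε g)
    (h : ∀ᵐ x, u x = (κ ^ 2 - μ ^ 2) * yukawaConv κ u x - yukawaConv κ g x) :
    u =ᵐ[volume] fun x => -yukawaConv μ g x := by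
  have hκ0 : 0 < κ.re := hε.trans_lt hκ
  have hμ0 : 0 < μ.re := hε.trans_lt hμ
  have hKu := hu.yukawaConv hε hκ
  have hKg := hg.yukawaConv hε hκ
  have hneg : ExpIntegrable ε (fun x => -yukawaConv μ g x) := by
    have := (hg.yukawaConv hε hμ).neg
    refine this.congr (Eventually.of_forall fun x => ?_)
    simp
  refine ae_eq_of_forall_testSchwartz hu hneg ?_
  rintro φ ⟨C, hC⟩
  set c := κ ^ 2 - μ ^ 2 with hc
  -- pairing of the equation with an exponentially decaying test function
  have hpair : ∀ (χ : 𝓢(R3, ℂ)) (C : ℝ), (∀ x, ‖χ x‖ ≤ C * Real.exp (-ε * ‖x‖)) →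
      ∫ x, u x * χ x = c * (∫ x, u x * schwartzResolvent κ χ x)
        - ∫ x, g x * schwartzResolvent κ χ x := by
    intro χ C hχ
    have hχm := χ.continuous.aestronglyMeasurable (μ := (volume : Measure R3))
    rw [schwartzResolvent_eq_yukawaConv hκ0, ← integral_yukawaConv_mul hε hκ hu hχm hχ,
      ← integral_yukawaConv_mul hε hκ hg hχm hχ, ← integral_const_mul,
      ← integral_sub ((hKu.integrable_mul hχm hχ).const_mul c) (hKg.integrable_mul hχm hχ)]
    refine integral_congr_ae ?_
    filter_upwards [h] with x hx
    rw [hx]; ring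
  set ψ := schwartzResolvent μ φ with hψ
  obtain ⟨Cψ, hψb⟩ : ∃ C, ∀ x, ‖ψ x‖ ≤ C * Real.exp (-ε * ‖x‖) := by
    rw [hψ, schwartzResolvent_eq_yukawaConv hμ0]
    exact ⟨_, norm_yukawaConv_le hε hμ hC⟩
  obtain ⟨Cφ, hκφb⟩ : ∃ C, ∀ x, ‖schwartzResolvent κ φ x‖ ≤ C * Real.exp (-ε * ‖x‖) := by
    rw [schwartzResolvent_eq_yukawaConv hκ0]
    exact ⟨_, norm_yukawaConv_le hε hκ hC⟩
  have e1 := hpair φ C hC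
  -- With `R_κ`, `R_μ` the Schwartz resolvents and `c R_κ R_μ = R_μ - R_κ`, the terms `∫ u ψ` cancel
  -- here and leave `∫ u R_κ φ = -∫ g R_κ ψ`. Inserting this in `e1` and using the identity once
  -- more, now on `g`, gives `∫ u φ = -∫ g R_μ φ`.
  have e2 := hpair ψ _ hψb
  have hsub : ∀ x, c * schwartzResolvent κ ψ x = ψ x - schwartzResolvent κ φ x := fun x => by
    have := congrArg (fun F : 𝓢(R3, ℂ) => F x) (schwartzResolvent_sub hκ0 hμ0 φ)
    exact this.symm
  have hint : ∀ w : R3 → ℂ, ExpIntegrable ε w → c * ∫ x, w x * schwartzResolvent κ ψ x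
      = (∫ x, w x * ψ x) - ∫ x, w x * schwartzResolvent κ φ x := by
    intro w hw
    rw [← integral_const_mul, ← integral_sub
      (hw.integrable_mul ψ.continuous.aestronglyMeasurable hψb)
      (hw.integrable_mul (schwartzResolvent κ φ).continuous.aestronglyMeasurable hκφb)]
    refine integral_congr_ae (Eventually.of_forall fun x => ?_)
    simp only
    linear_combination w x * hsub x
  rw [hint u hu] at e2
  have e3 : c * ∫ x, u x * schwartzResolvent κ φ x
      = -(c * ∫ x, g x * schwartzResolvent κ ψ x) := by linear_combination c * e2
  rw [hint g hg] at e3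
  have e4 : ∫ x, -yukawaConv μ g x * φ x = -∫ x, g x * ψ x := by
    rw [hψ, schwartzResolvent_eq_yukawaConv hμ0,
      ← integral_yukawaConv_mul hε hμ hg φ.continuous.aestronglyMeasurable hC, ← integral_neg]
    simp only [neg_mul]
  rw [e4, e1, e3]
  ring

/-! ### The sharp constant and the contraction argument -/

theorem holderConjugate_gamma {γ : ℝ} (hγ : 0 < γ) :
    ((2 * γ + 3) / (2 * γ + 1)).HolderConjugate (γ + 3 / 2) := by
  rw [Real.holderConjugate_iff]
  refine ⟨?_, ?_⟩
  · rw [lt_div_iff₀ (by linarith)]; linarith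
  · have h1 : 2 * γ + 1 ≠ 0 := by positivity
    have h2 : 2 * γ + 3 ≠ 0 := by positivity
    have h3 : γ + 3 / 2 ≠ 0 := by positivity
    field_simp
    ring

/-- With `s` and `r` the Hölder pair, this is `‖G_κ‖_s ^ r`. The outer exponent `r/s = (2γ+1)/2`
turns the powers of `4π` and of `s Re κ` into `-1` and `-2γ`, producing the constant of the theorem
apart from its sine factor. -/
theorem rpow_integral_yukawa {γ : ℝ} (hγ : 0 < γ) {κ : ℂ} (hκ : 0 < κ.re) :
    (∫ x : R3, ‖yukawa κ x‖ ^ ((2 * γ + 3) / (2 * γ + 1))) ^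
        (1 / ((2 * γ + 3) / (2 * γ + 1)) * (γ + 3 / 2))
      = 1 / (4 * Real.pi) * ((2 * γ + 1) / (2 * γ + 3)) ^ (2 * γ) *
        Real.Gamma (4 * γ / (2 * γ + 1)) ^ ((2 * γ + 1) / 2) * κ.re ^ (-(2 * γ)) := by
  have h1 : 0 < 2 * γ + 1 := by positivity
  have h2 : 0 < 2 * γ + 3 := by positivity
  have e1 : 1 / ((2 * γ + 3) / (2 * γ + 1)) * (γ + 3 / 2) = (2 * γ + 1) / 2 := by
    field_simp
  have e2 : 3 - (2 * γ + 3) / (2 * γ + 1) = 4 * γ / (2 * γ + 1) := by field_simp; ring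
  have e3 : (1 - (2 * γ + 3) / (2 * γ + 1)) * ((2 * γ + 1) / 2) = -1 := by field_simp; ring
  have e4 : ((2 * γ + 3) / (2 * γ + 1) - 3) * ((2 * γ + 1) / 2) = -(2 * γ) := by field_simp; ring
  have hΓ : 0 < Real.Gamma (4 * γ / (2 * γ + 1)) := Real.Gamma_pos_of_pos (by positivity)
  rw [integral_yukawa_rpow hκ (by positivity) (by rw [div_lt_iff₀ h1]; linarith), e1, e2,
    Real.mul_rpow (by positivity) (by positivity), Real.mul_rpow (by positivity) hΓ.le,
    ← Real.rpow_mul (by positivity), ← Real.rpow_mul (by positivity), e3, e4,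
    Real.mul_rpow (by positivity) hκ.le, Real.rpow_neg_one,
    Real.rpow_neg (x := (2 * γ + 3) / (2 * γ + 1)) (by positivity),
    ← Real.inv_rpow (by positivity), inv_div]
  ring

/-- The hypothesis says that the `r`-th power of `‖G_κ‖_s ‖q‖_r` is below 1; Hölder and translation
invariance make the bound uniform in `y`. -/
theorem lintegral_yukawa_mul_lt_one {γ : ℝ} (hγ : 0 < γ) {q : R3 → ℂ}
    (hq : MemLp q (ENNReal.ofReal (γ + 3 / 2)) volume) {κ : ℂ} (hκ : 0 < κ.re)
    (hlt : 1 / (4 * Real.pi) * ((2 * γ + 1) / (2 * γ + 3)) ^ (2 * γ) *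
      Real.Gamma (4 * γ / (2 * γ + 1)) ^ ((2 * γ + 1) / 2) * ∫ x : R3, ‖q x‖ ^ (γ + 3 / 2)
        < κ.re ^ (2 * γ)) :
    ∃ K < 1, ∀ y, ∫⁻ x, ‖yukawa κ (x - y)‖ₑ * ‖q x‖ₑ ≤ K := by
  set s := (2 * γ + 3) / (2 * γ + 1) with hs
  set r := γ + 3 / 2 with hr
  have hsr : s.HolderConjugate r := holderConjugate_gamma hγ
  have hs0 := hsr.pos
  have hr0 := hsr.symm.pos
  have hs3 : s < 3 := by rw [hs, div_lt_iff₀ (by linarith)]; linarith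
  set I := ∫ x : R3, ‖q x‖ ^ r with hI
  have hI0 : 0 ≤ I := integral_nonneg fun x => by positivity
  set A := ∫ x : R3, ‖yukawa κ x‖ ^ s with hA
  have hA0 : 0 ≤ A := integral_nonneg fun x => by positivity
  have hAeq : ∫⁻ x, ‖yukawa κ x‖ₑ ^ s = ENNReal.ofReal A := by
    rw [hA, ofReal_integral_eq_lintegral_ofReal (integrable_yukawa_rpow hκ hs0 hs3)
      (Eventually.of_forall fun x => by positivity)]
    refine lintegral_congr fun x => ?_
    rw [← ofReal_norm, ENNReal.ofReal_rpow_of_nonneg (norm_nonneg _) hs0.le]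
  have hqi : Integrable (fun x => ‖q x‖ ^ r) := by
    have := hq.integrable_norm_rpow (by simpa using hr0) ENNReal.ofReal_ne_top
    rwa [ENNReal.toReal_ofReal hr0.le] at this
  have hIeq : ∫⁻ x, ‖q x‖ₑ ^ r = ENNReal.ofReal I := by
    rw [hI, ofReal_integral_eq_lintegral_ofReal hqi (Eventually.of_forall fun x => by positivity)]
    refine lintegral_congr fun x => ?_
    rw [← ofReal_norm, ENNReal.ofReal_rpow_of_nonneg (norm_nonneg _) hr0.le]
  have hreal : A ^ (1 / s) * I ^ (1 / r) < 1 := by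
    have hpow : (A ^ (1 / s) * I ^ (1 / r)) ^ r < 1 := by
      rw [Real.mul_rpow (by positivity) (by positivity), ← Real.rpow_mul hA0, ← Real.rpow_mul hI0,
        one_div_mul_cancel hr0.ne', Real.rpow_one, hA, rpow_integral_yukawa hγ hκ]
      have hk : 0 < κ.re ^ (2 * γ) := by positivity
      rw [← div_lt_one hk] at hlt
      refine lt_of_eq_of_lt ?_ hlt
      rw [Real.rpow_neg hκ.le]
      ring
    by_contra! h1
    exact absurd (Real.one_le_rpow h1 hr0.le) (not_le.2 hpow)
  refine ⟨ENNReal.ofReal (A ^ (1 / s) * I ^ (1 / r)), by simpa using hreal, fun y => ?_⟩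
  have hG : Measurable fun x => yukawa κ (x - y) :=
    (measurable_yukawa κ).comp (measurable_id.sub_const y)
  refine (ENNReal.lintegral_mul_le_Lp_mul_Lq volume hsr hG.enorm.aemeasurable hq.1.enorm).trans ?_
  rw [lintegral_sub_right_eq_self (fun x => ‖yukawa κ x‖ₑ ^ s) y, hAeq, hIeq,
    ENNReal.ofReal_rpow_of_nonneg hA0 (by positivity),
    ENNReal.ofReal_rpow_of_nonneg hI0 (by positivity), ← ENNReal.ofReal_mul (by positivity)]

theorem ae_eq_zero_of_yukawa_equation {γ : ℝ} (hγ : 0 < γ) {q : R3 → ℂ}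
    (hq : MemLp q (ENNReal.ofReal (γ + 3 / 2)) volume) {μ : ℂ} (hμ : 0 < μ.re)
    (hlt : 1 / (4 * Real.pi) * ((2 * γ + 1) / (2 * γ + 3)) ^ (2 * γ) *
      Real.Gamma (4 * γ / (2 * γ + 1)) ^ ((2 * γ + 1) / 2) * ∫ x : R3, ‖q x‖ ^ (γ + 3 / 2)
        < μ.re ^ (2 * γ))
    {u g : R3 → ℂ} (hg : ∀ ε > 0, ExpIntegrable ε g) (hgq : ∀ᵐ x, g x = q x * u x)
    (hu : u =ᵐ[volume] fun x => -yukawaConv μ g x) : u =ᵐ[volume] 0 := by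
  -- The strict inequality survives replacing `Re μ` by a slightly smaller `k`; the gap `ε` is spent
  -- on the exponential weight.
  obtain ⟨k, hk, hk0, hklt⟩ : ∃ k, 0 < k ∧ k < μ.re ∧
      1 / (4 * Real.pi) * ((2 * γ + 1) / (2 * γ + 3)) ^ (2 * γ) *
      Real.Gamma (4 * γ / (2 * γ + 1)) ^ ((2 * γ + 1) / 2) * ∫ x : R3, ‖q x‖ ^ (γ + 3 / 2)
        < k ^ (2 * γ) := by
    have hcont : ContinuousAt (fun k : ℝ => k ^ (2 * γ)) μ.re :=
      Real.continuousAt_rpow_const _ _ (Or.inl hμ.ne')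
    have h1 := hcont.eventually (lt_mem_nhds hlt)
    have h2 : ∀ᶠ k in 𝓝 μ.re, 0 < k := lt_mem_nhds hμ
    obtain ⟨k, ⟨hk1, hk2⟩, hk3⟩ := (((h1.and h2).filter_mono nhdsWithin_le_nhds).and
      (self_mem_nhdsWithin (s := Iio μ.re))).exists
    exact ⟨k, hk2, hk3, hk1⟩
  set ε := μ.re - k with hε
  have hε0 : 0 < ε := by linarith
  have hre : (μ - ε).re = k := by simp [hε]
  obtain ⟨K, hK1, hK⟩ := lintegral_yukawa_mul_lt_one hγ hq (κ := μ - ε) (by rwa [hre])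
    (by rwa [hre])
  obtain ⟨hm, hfin⟩ := expIntegrable_iff.1 (hg ε hε0)
  have hle := lintegral_enorm_yukawaConv_le μ hε0.le hq.1.enorm hm hK
  -- Taking `V = |q|` in the Schur estimate closes the loop, since `|q| |G_μ * g| = |q u| = |g|`.
  have heq : ∫⁻ x, ‖yukawaConv μ g x‖ₑ * (‖q x‖ₑ * expWeight ε x)
      = ∫⁻ x, ‖g x‖ₑ * expWeight ε x := by
    refine lintegral_congr_ae ?_
    filter_upwards [hu, hgq] with x h1 h2
    rw [h2, h1, enorm_mul, enorm_neg]
    ring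
  rw [heq] at hle
  have hzero : ∫⁻ x, ‖g x‖ₑ * expWeight ε x = 0 := by
    by_contra hne
    have := ENNReal.mul_lt_mul_left hne hfin.ne hK1
    rw [one_mul] at this
    exact absurd hle (not_le.2 this)
  have hgm : AEMeasurable (fun x => ‖g x‖ₑ * expWeight ε x) :=
    hm.enorm.mul (measurable_expWeight ε).aemeasurable
  rw [lintegral_eq_zero_iff' hgm] at hzero
  have hg0 : g =ᵐ[volume] fun _ => 0 := by
    filter_upwards [hzero] with x hx
    have := mul_eq_zero.1 hx
    simpa [expWeight_ne_zero] using this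
  rw [yukawaConv_congr μ hg0] at hu
  filter_upwards [hu] with x hx
  rw [hx]
  simp [yukawaConv]

/-! ### Graph calculus for unbounded operators -/

section Graphs

variable {E : Type*} [NormedAddCommGroup E] [NormedSpace ℂ E]

theorem mem_graph_sub_iff {S T : E →ₗ.[ℂ] E} {x y : E} :
    (x, y) ∈ (S - T).graph ↔ ∃ s t, (x, s) ∈ S.graph ∧ (x, t) ∈ T.graph ∧ y = s - t := by
  constructor
  · intro h
    obtain ⟨u, hu, hy⟩ := (LinearPMap.mem_graph_iff _).1 h
    have hu' : (u : E) ∈ S.domain ⊓ T.domain := u.2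
    refine ⟨S ⟨u, hu'.1⟩, T ⟨u, hu'.2⟩, ?_, ?_, ?_⟩
    · rw [LinearPMap.mem_graph_iff]; exact ⟨_, hu, rfl⟩
    · rw [LinearPMap.mem_graph_iff]; exact ⟨_, hu, rfl⟩
    · exact hy.symm.trans (LinearPMap.sub_apply S T u)
  · rintro ⟨s, t, hs, ht, rfl⟩
    obtain ⟨u, hu, hs'⟩ := (LinearPMap.mem_graph_iff _).1 hs
    obtain ⟨v, hv, ht'⟩ := (LinearPMap.mem_graph_iff _).1 ht
    simp only at hu hv hs' ht'
    subst hu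
    have hd : (u : E) ∈ S.domain ⊓ T.domain := ⟨u.2, by rw [← hv]; exact v.2⟩
    rw [LinearPMap.mem_graph_iff]
    refine ⟨⟨u, hd⟩, rfl, ?_⟩
    rw [← hs', ← ht']
    refine (LinearPMap.sub_apply S T ⟨u, hd⟩).trans ?_
    congr 2
    exact Subtype.ext hv.symm

theorem mem_graph_scalarOp {c : ℂ} {x y : E} : (x, y) ∈ (scalarOp E c).graph ↔ y = c • x := by
  rw [LinearPMap.mem_graph_iff]
  constructor
  · rintro ⟨u, hu, hy⟩
    simp only at hu hy
    rw [← hy, ← hu]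
    rfl
  · rintro rfl
    exact ⟨⟨x, trivial⟩, rfl, rfl⟩

theorem mem_graph_sub_scalarOp_iff {T : E →ₗ.[ℂ] E} {c : ℂ} {x y : E} :
    (x, y) ∈ (T - scalarOp E c).graph ↔ (x, y + c • x) ∈ T.graph := by
  rw [mem_graph_sub_iff]
  constructor
  · rintro ⟨s, t, hs, ht, rfl⟩
    rw [mem_graph_scalarOp] at ht
    rw [ht, sub_add_cancel]
    exact hs
  · intro h
    exact ⟨_, _, h, mem_graph_scalarOp.2 rfl, (add_sub_cancel_right _ _).symm⟩

theorem apply_add_scalarOp (T : E →ₗ.[ℂ] E) (c : ℂ) (u : (T + scalarOp E c).domain) :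
    ((u : E), (T + scalarOp E c) u - c • (u : E)) ∈ T.graph := by
  have hu : (u : E) ∈ T.domain ⊓ (scalarOp E c).domain := u.2
  rw [LinearPMap.mem_graph_iff]
  refine ⟨⟨u, hu.1⟩, rfl, ?_⟩
  have h := LinearPMap.add_apply T (scalarOp E c) u
  have h2 : (scalarOp E c) ⟨u, hu.2⟩ = c • (u : E) := rfl
  rw [h]
  change _ = _ + (scalarOp E c) ⟨u, hu.2⟩ - c • (u : E)
  rw [h2, add_sub_cancel_right]

/-- Trivial kernel is what makes the swapped graph single-valued. Hence injectivity is checked for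
each operator before its inverse is used. -/
theorem mem_graph_inverse_iff {T : E →ₗ.[ℂ] E} (hT : ∀ x, (x, (0 : E)) ∈ T.graph → x = 0) {x y : E} :
    (y, x) ∈ T.inverse.graph ↔ (x, y) ∈ T.graph := by
  have hker : LinearMap.ker T.toFun = ⊥ := by
    rw [LinearMap.ker_eq_bot']
    intro u hu
    have := hT u ((LinearPMap.mem_graph_iff _).2 ⟨u, rfl, hu⟩)
    exact Subtype.ext this
  rw [LinearPMap.inverse_graph hker, Submodule.mem_map]
  constructor
  · rintro ⟨⟨a, b⟩, hab, h⟩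
    simp only [LinearEquiv.coe_coe, LinearEquiv.prodComm_apply, Prod.swap_prod_mk,
      Prod.mk.injEq] at h
    rwa [← h.1, ← h.2]
  · intro h
    exact ⟨(x, y), h, rfl⟩

theorem mem_graph_resolventOp_iff {T : E →ₗ.[ℂ] E} {c : ℂ}
    (hT : ∀ x, (x, c • x) ∈ T.graph → x = 0) {x y : E} :
    (y, x) ∈ (resolventOp T c).graph ↔ (x, y + c • x) ∈ T.graph := by
  rw [resolventOp, mem_graph_inverse_iff, mem_graph_sub_scalarOp_iff]
  intro x hx
  rw [mem_graph_sub_scalarOp_iff, zero_add] at hx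
  exact hT x hx

theorem IsRegularPoint.eq_zero {T : E →ₗ.[ℂ] E} {c : ℂ} (h : IsRegularPoint T c) {x : E}
    (hx : (x, c • x) ∈ T.graph) : x = 0 := by
  obtain ⟨S, hS⟩ := h
  have := (hS x 0).1 (mem_graph_sub_scalarOp_iff.2 (by rwa [zero_add]))
  rw [this, map_zero]

theorem mem_graph_opComp_iff {S T : E →ₗ.[ℂ] E} {x y : E} :
    (x, y) ∈ (opComp S T).graph ↔ ∃ v, (x, v) ∈ T.graph ∧ (v, y) ∈ S.graph := by
  rw [opComp_graph]; rfl

theorem exists_seq_of_mem_graph_closure {T : E →ₗ.[ℂ] E} {x y : E} (h : (x, y) ∈ T.closure.graph) :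
    ∃ s t : ℕ → E, (∀ n, (s n, t n) ∈ T.graph) ∧ Tendsto s atTop (𝓝 x) ∧ Tendsto t atTop (𝓝 y) := by
  have hcl : (x, y) ∈ closure (T.graph : Set (E × E)) := by
    -- For an operator that is not closable, `LinearPMap.closure` returns the operator itself, so
    -- the approximating sequences exist without a proof of closability.
    by_cases hT : T.IsClosable
    · rw [← hT.graph_closure_eq_closure_graph] at h
      exact h
    · rw [LinearPMap.closure_def' hT] at h
      exact subset_closure h
  obtain ⟨z, hz, hlim⟩ := mem_closure_iff_seq_limit.1 hcl
  exact ⟨fun n => (z n).1, fun n => (z n).2, hz, (continuous_fst.tendsto _).comp hlim,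
    (continuous_snd.tendsto _).comp hlim⟩

end Graphs

/-! ### The perturbed resolvent and the eigenfunction equation -/

variable {p : ℝ≥0∞} [Fact (1 ≤ p)]

theorem mem_graph_mulOp_iff {a : R3 → ℂ} {u f : LpR3 p} :
    (u, f) ∈ (mulOp p a).graph ↔ ∀ᵐ y ∂(volume : Measure R3), f y = a y * u y := by
  rw [mulOp_graph]; rfl

theorem resolvent_equation_of_mem_graph_freeOp {z : ℂ} {v f : LpR3 p}
    (h : (v, f + z • v) ∈ (freeOp p).graph) :
    (f : 𝓢'(R3, ℂ)) = -Δ (v : 𝓢'(R3, ℂ)) + (-z) • (v : 𝓢'(R3, ℂ)) := by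
  rw [freeOp_graph] at h
  have h1 : ((f + z • v : LpR3 p) : 𝓢'(R3, ℂ)) = (f : 𝓢'(R3, ℂ)) + z • (v : 𝓢'(R3, ℂ)) := by
    have h2 := map_add (Lp.toTemperedDistributionCLM ℂ (volume : Measure R3) p) f (z • v)
    rw [map_smul] at h2
    exact h2
  have h3 : ((f + z • v : LpR3 p) : 𝓢'(R3, ℂ)) = -Δ (v : 𝓢'(R3, ℂ)) := h.2
  rw [h1] at h3
  rw [← h3, neg_smul, add_neg_cancel_right]

theorem yukawaConv_zero (κ : ℂ) {h : R3 → ℂ} (hh : h =ᵐ[volume] 0) : yukawaConv κ h = 0 := by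
  rw [yukawaConv_congr κ hh]
  ext x
  simp [yukawaConv]

theorem ae_eq_yukawaConv_of_mem_graph_freeOp (hp1 : 1 < p) (hp2 : p < ⊤) {κ : ℂ} (hκ : 0 < κ.re)
    {v f : LpR3 p} (h : (v, f + (-κ ^ 2) • v) ∈ (freeOp p).graph) :
    (v : R3 → ℂ) =ᵐ[volume] yukawaConv κ f := by
  refine ae_eq_yukawaConv_of_resolvent_equation hp1 hp2 hκ ?_
  have := resolvent_equation_of_mem_graph_freeOp h
  rwa [neg_neg] at this

theorem freeOp_no_eigenvalue (hp1 : 1 < p) (hp2 : p < ⊤) {κ : ℂ} (hκ : 0 < κ.re) (v : LpR3 p)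
    (h : (v, (-κ ^ 2) • v) ∈ (freeOp p).graph) : v = 0 := by
  have h1 := ae_eq_yukawaConv_of_mem_graph_freeOp hp1 hp2 hκ (f := 0) (by rwa [zero_add])
  rw [yukawaConv_zero κ (Lp.coeFn_zero _ _ _)] at h1
  exact Lp.ext (h1.trans (Lp.coeFn_zero _ _ _).symm)

theorem mem_graph_freeResolvent_iff (hp1 : 1 < p) (hp2 : p < ⊤) {κ : ℂ} (hκ : 0 < κ.re)
    {v f : LpR3 p} :
    (f, v) ∈ (resolventOp (freeOp p) (-κ ^ 2)).graph ↔ (v, f + (-κ ^ 2) • v) ∈ (freeOp p).graph :=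
  mem_graph_resolventOp_iff (freeOp_no_eigenvalue hp1 hp2 hκ)

/-- Continuity of `h ↦ b (G_κ * (a h))` along sequences converging in `L_p`. -/
theorem ae_eq_mul_yukawaConv_of_tendsto (hp1 : 1 < p) (hp2 : p < ⊤) {κ : ℂ} (hκ : 0 < κ.re)
    {a b : R3 → ℂ} (ha : IsStummel p.toReal.conjExponent a) {h s y : ℕ → LpR3 p} {w t : LpR3 p}
    (hy : ∀ n, (y n : R3 → ℂ) =ᵐ[volume] yukawaConv κ (fun x => a x * h n x))
    (hs : ∀ n, ∀ᵐ x, s n x = b x * y n x) (hw : Tendsto h atTop (𝓝 w))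
    (ht : Tendsto s atTop (𝓝 t)) :
    ∀ᵐ x, t x = b x * yukawaConv κ (fun x => a x * w x) x := by
  have := holderConjugate_conjExponent hp1 hp2
  set ε := κ.re / 2 with hε
  have hε0 : 0 < ε := by positivity
  have hεκ : ε < κ.re := by linarith
  have hae := ha.memLp_exp_smul (conjExponent_pos hp1 hp2) hε0
  have hexp : ∀ w : LpR3 p, ExpIntegrable ε (fun x => a x * w x) :=
    fun w => expIntegrable_mul hae (Lp.memLp w)
  set D := eLpNorm (fun x => Real.exp (-ε * ‖x‖) • a x)
    (ENNReal.ofReal p.toReal.conjExponent) volume with hD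
  set K := ∫⁻ x, ‖yukawa (κ - ε) x‖ₑ with hK
  have hKfin : K < ⊤ := (integrable_yukawa (by simpa using hεκ)).2
  set F : ℕ → R3 → ℂ := fun n x => Real.exp (-ε * ‖x‖) • y n x with hF
  set F₀ : R3 → ℂ := fun x => Real.exp (-ε * ‖x‖) • yukawaConv κ (fun x => a x * w x) x with hF₀
  -- Only `h n` and `s n` are known to converge in `L_p`; the intermediate `y n` is controlled in
  -- the weighted `L_1`, by Hölder for `a (h n - w)` and the Schur bound for the kernel.
  have hbound : ∀ n, eLpNorm (F n - F₀) 1 volume ≤ K * (D * eLpNorm (⇑(h n) - ⇑w) p volume) := by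
    intro n
    have hd : ∀ᵐ x, (F n - F₀) x = Real.exp (-ε * ‖x‖) • yukawaConv κ
        (fun x => a x * (⇑(h n) - ⇑w) x) x := by
      filter_upwards [hy n, yukawaConv_sub_ae hε0.le hεκ (hexp (h n)) (hexp w)] with x h1 h2
      simp only [hF, hF₀, Pi.sub_apply, h1, ← smul_sub, ← h2, mul_sub]
    rw [eLpNorm_congr_ae hd, eLpNorm_one_eq_lintegral_enorm]
    simp only [enorm_exp_smul]
    have hmem : MemLp (⇑(h n) - ⇑w) p volume := (Lp.memLp (h n)).sub (Lp.memLp w)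
    have h1 := lintegral_enorm_yukawaConv_le κ hε0.le (V := fun _ => 1) aemeasurable_const
      (expIntegrable_mul (p := p) hae hmem).aestronglyMeasurable
      (lintegral_enorm_yukawa_translate (κ - ε))
    simp only [one_mul] at h1
    refine h1.trans (mul_le_mul_right ?_ _)
    exact lintegral_enorm_mul_expWeight_le hae hmem
  have htend : Tendsto (fun n => eLpNorm (F n - F₀) 1 volume) atTop (𝓝 0) := by
    have h1 := (Lp.tendsto_Lp_iff_tendsto_eLpNorm' h w).1 hw
    have h2 : Tendsto (fun n => K * (D * eLpNorm (⇑(h n) - ⇑w) p volume)) atTop (𝓝 (K * (D * 0))) :=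
      ENNReal.Tendsto.const_mul (ENNReal.Tendsto.const_mul h1 (Or.inr hae.2.ne)) (Or.inr hKfin.ne)
    rw [mul_zero, mul_zero] at h2
    exact tendsto_of_tendsto_of_tendsto_of_le_of_le tendsto_const_nhds h2 (fun _ => zero_le) hbound
  have hec : Continuous fun x : R3 => Real.exp (-ε * ‖x‖) := by fun_prop
  have hmeas := tendstoInMeasure_of_tendsto_eLpNorm (p := 1) one_ne_zero
    (fun n => hec.aestronglyMeasurable.smul (Lp.aestronglyMeasurable (y n)))
    (hec.aestronglyMeasurable.smul (aestronglyMeasurable_yukawaConv κ (hexp w).aestronglyMeasurable))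
    htend
  -- A subsequence of `y n` and then a further one of `s n` converge almost everywhere, so the
  -- relation `s n = b y n` passes to the limit pointwise.
  obtain ⟨ns, hns, hlim1⟩ := hmeas.exists_seq_tendsto_ae
  obtain ⟨ms, hms, hlim2⟩ := (tendstoInMeasure_of_tendsto_Lp
    (ht.comp hns.tendsto_atTop)).exists_seq_tendsto_ae
  filter_upwards [hlim1, hlim2, ae_all_iff.2 hs] with x h1 h2 h3
  have h4 : Tendsto (fun i => b x * y (ns (ms i)) x) atTop
      (𝓝 (b x * yukawaConv κ (fun x => a x * w x) x)) := by
    refine Tendsto.const_mul _ ?_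
    have h5 : Tendsto (fun i => Real.exp (ε * ‖x‖) • (Real.exp (-ε * ‖x‖) • y (ns (ms i)) x)) atTop
        (𝓝 (Real.exp (ε * ‖x‖) • (Real.exp (-ε * ‖x‖) • yukawaConv κ (fun x => a x * w x) x))) :=
      (h1.comp hms.tendsto_atTop).const_smul (Real.exp (ε * ‖x‖))
    have hcancel : ∀ c : ℂ, Real.exp (ε * ‖x‖) • (Real.exp (-ε * ‖x‖) • c) = c := fun c => by
      rw [smul_smul, ← Real.exp_add]; simp
    simpa only [hcancel] using h5
  refine tendsto_nhds_unique ?_ h4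
  refine h2.congr fun i => ?_
  exact h3 (ns (ms i))

theorem mem_graph_resolvent_mul (hp1 : 1 < p) (hp2 : p < ⊤) {κ : ℂ} (hκ : 0 < κ.re) {a : R3 → ℂ}
    {h y : LpR3 p}
    (hy : (h, y) ∈ (opComp (resolventOp (freeOp p) (-κ ^ 2)) (mulOp p a)).graph) :
    (y : R3 → ℂ) =ᵐ[volume] yukawaConv κ (fun x => a x * h x) := by
  obtain ⟨v, hv, hvy⟩ := mem_graph_opComp_iff.1 hy
  have h1 := ae_eq_yukawaConv_of_mem_graph_freeOp hp1 hp2 hκ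
    ((mem_graph_freeResolvent_iff hp1 hp2 hκ).1 hvy)
  rwa [yukawaConv_congr κ (mem_graph_mulOp_iff.1 hv)] at h1

theorem ae_eq_of_mem_graph_resolventMul (hp1 : 1 < p) (hp2 : p < ⊤) {κ : ℂ} (hκ : 0 < κ.re)
    {a : R3 → ℂ} (ha : IsStummel p.toReal.conjExponent a) {w y : LpR3 p}
    (h : (w, y) ∈ (resolventMul p a (-κ ^ 2)).graph) :
    (y : R3 → ℂ) =ᵐ[volume] yukawaConv κ (fun x => a x * w x) := by
  obtain ⟨s, t, hst, hs, ht⟩ := exists_seq_of_mem_graph_closure h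
  have := ae_eq_mul_yukawaConv_of_tendsto hp1 hp2 hκ (b := fun _ => 1) ha
    (fun n => mem_graph_resolvent_mul hp1 hp2 hκ (hst n))
    (fun n => Eventually.of_forall fun x => (one_mul _).symm) hs ht
  simp only [one_mul] at this
  exact this

theorem ae_eq_of_mem_graph_borderedResolvent (hp1 : 1 < p) (hp2 : p < ⊤) {κ : ℂ} (hκ : 0 < κ.re)
    {a b : R3 → ℂ} (ha : IsStummel p.toReal.conjExponent a) {w s : LpR3 p}
    (h : (w, s) ∈ (borderedResolvent p a b (-κ ^ 2)).graph) :
    ∀ᵐ x, s x = b x * yukawaConv κ (fun x => a x * w x) x := by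
  obtain ⟨h, t, hst, hs, ht⟩ := exists_seq_of_mem_graph_closure h
  choose y hy hyt using fun n => mem_graph_opComp_iff.1 (hst n)
  exact ae_eq_mul_yukawaConv_of_tendsto hp1 hp2 hκ ha
    (fun n => mem_graph_resolvent_mul hp1 hp2 hκ (hy n))
    (fun n => mem_graph_mulOp_iff.1 (hyt n)) hs ht

/-- Structure of the range of the perturbed resolvent. -/
theorem exists_of_mem_graph_perturbedResolvent (hp1 : 1 < p) (hp2 : p < ⊤) {κ : ℂ} (hκ : 0 < κ.re)
    {a b : R3 → ℂ} (ha : IsStummel p.toReal.conjExponent a)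
    (hQ : IsRegularPoint (borderedResolvent p a b (-κ ^ 2)) (-1)) {f u : LpR3 p}
    (h : (f, u) ∈ (perturbedResolvent p a b (-κ ^ 2)).graph) :
    ∃ w y : LpR3 p, (y, f + (-κ ^ 2) • y) ∈ (freeOp p).graph ∧ (∀ᵐ x, w x = b x * u x) ∧
      ∀ᵐ x, u x = y x - yukawaConv κ (fun x => a x * w x) x := by
  obtain ⟨y, y₁, hy, hy₁, rfl⟩ := mem_graph_sub_iff.1 h
  obtain ⟨w, hw, hwy₁⟩ := mem_graph_opComp_iff.1 hy₁
  obtain ⟨s, hs, hsw⟩ := mem_graph_opComp_iff.1 hw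
  obtain ⟨y', hy', hy's⟩ := mem_graph_opComp_iff.1 hs
  obtain rfl : y' = y := LinearPMap.mem_graph_snd_inj _ hy' hy rfl
  have hRA := ae_eq_of_mem_graph_resolventMul hp1 hp2 hκ ha hwy₁
  -- This reads `Q w = s - w` with `s = b y'`. Since `Q w = b y₁`, it follows that `w = b (y' -
  -- y₁)`, that is, `w = b u`.
  rw [mem_graph_resolventOp_iff fun x hx => hQ.eq_zero hx] at hsw
  have hQw := ae_eq_of_mem_graph_borderedResolvent hp1 hp2 hκ ha hsw
  rw [neg_one_smul, ← sub_eq_add_neg] at hQw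
  refine ⟨w, y', (mem_graph_freeResolvent_iff hp1 hp2 hκ).1 hy, ?_, ?_⟩
  · filter_upwards [hQw, hRA, mem_graph_mulOp_iff.1 hy's, Lp.coeFn_sub s w, Lp.coeFn_sub y' y₁]
      with x h1 h2 h3 h4 h5
    rw [h4, Pi.sub_apply, h3, ← h2] at h1
    rw [h5, Pi.sub_apply]
    linear_combination -h1
  · filter_upwards [hRA, Lp.coeFn_sub y' y₁] with x h1 h2
    rw [h2, Pi.sub_apply, h1]

/-- If the image `u` vanishes, then so does `w = b u`, hence `y = u + G_κ * (a w)` vanishes, and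
with it `f = (H₀ - z) y`. -/
theorem perturbedResolvent_injective (hp1 : 1 < p) (hp2 : p < ⊤) {κ : ℂ} (hκ : 0 < κ.re)
    {a b : R3 → ℂ} (ha : IsStummel p.toReal.conjExponent a)
    (hQ : IsRegularPoint (borderedResolvent p a b (-κ ^ 2)) (-1)) (f : LpR3 p)
    (h : (f, (0 : LpR3 p)) ∈ (perturbedResolvent p a b (-κ ^ 2)).graph) : f = 0 := by
  obtain ⟨w, y, hy, hw, hu⟩ := exists_of_mem_graph_perturbedResolvent hp1 hp2 hκ ha hQ h
  have h0 := Lp.coeFn_zero ℂ p (volume : Measure R3)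
  have hw0 : (fun x => a x * w x) =ᵐ[volume] 0 := by
    filter_upwards [hw, h0] with x h1 h2
    simp [h1]
  rw [yukawaConv_zero κ hw0] at hu
  have hy0 : y = 0 := by
    refine Lp.ext ?_
    filter_upwards [hu, h0] with x h1 h2
    rw [h2] at h1 ⊢
    simpa using h1.symm
  rw [hy0, smul_zero, add_zero] at hy
  exact (freeOp p).graph_fst_eq_zero_snd hy rfl

/-- Integral equation satisfied by the eigenfunctions of the Schrödinger operator. -/
theorem exists_eigenfunction (hp1 : 1 < p) (hp2 : p < ⊤) {κ μ : ℂ} (hκ : 0 < κ.re)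
    (hμ : 0 < μ.re) {q a b : R3 → ℂ} (hab : ∀ᵐ x ∂(volume : Measure R3), q x = a x * b x)
    (ha : IsStummel p.toReal.conjExponent a)
    (hQ : IsRegularPoint (borderedResolvent p a b (-κ ^ 2)) (-1))
    (hev : IsEigenvalue (schrodingerOp p a b (-κ ^ 2)) (-μ ^ 2)) :
    ∃ (u : LpR3 p) (g : R3 → ℂ), u ≠ 0 ∧ (∀ ε > 0, ExpIntegrable ε g) ∧
      (∀ᵐ x, g x = q x * u x) ∧ u =ᵐ[volume] fun x => -yukawaConv μ g x := by
  have := holderConjugate_conjExponent hp1 hp2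
  obtain ⟨⟨u, hud⟩, hu0, hu⟩ := hev
  have hgr := apply_add_scalarOp (perturbedResolvent p a b (-κ ^ 2)).inverse (-κ ^ 2) ⟨u, hud⟩
  change (u, schrodingerOp p a b (-κ ^ 2) ⟨u, hud⟩ - (-κ ^ 2) • u) ∈ _ at hgr
  -- The eigenvalue equation becomes `u = R(z; H) ((l - z) u)`, where `l - z = κ² - μ²`.
  rw [hu, mem_graph_inverse_iff (perturbedResolvent_injective hp1 hp2 hκ ha hQ), ← sub_smul] at hgr
  obtain ⟨w, y, hy, hw, hue⟩ := exists_of_mem_graph_perturbedResolvent hp1 hp2 hκ ha hQ hgr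
  have hyG := ae_eq_yukawaConv_of_mem_graph_freeOp hp1 hp2 hκ hy
  have hag : ∀ ε > 0, ExpIntegrable ε (fun x => a x * w x) := fun ε hε =>
    expIntegrable_mul (p := p) (ha.memLp_exp_smul (conjExponent_pos hp1 hp2) hε) (Lp.memLp w)
  refine ⟨u, fun x => a x * w x, hu0, hag, ?_, ?_⟩
  · filter_upwards [hab, hw] with x h1 h2
    rw [h1, h2]; ring
  obtain ⟨ε, hε, hεm⟩ := exists_between (lt_min hκ hμ)
  rw [lt_min_iff] at hεm
  have hue' : ExpIntegrable ε u := by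
    simpa only [one_mul] using expIntegrable_mul (p := p)
      (memLp_exp_smul_one (conjExponent_pos hp1 hp2) hε) (Lp.memLp u)
  refine ae_eq_neg_yukawaConv hε.le hεm.1 hεm.2 hue' (hag ε hε) ?_
  have hsm : yukawaConv κ ((((-μ ^ 2 - -κ ^ 2 : ℂ)) • u : LpR3 p) : R3 → ℂ)
      = fun x => (κ ^ 2 - μ ^ 2) * yukawaConv κ u x := by
    rw [yukawaConv_congr κ (Lp.coeFn_smul _ u)]
    ext x
    simp only [yukawaConv, ← integral_const_mul, Pi.smul_apply, smul_eq_mul]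
    refine integral_congr_ae (Eventually.of_forall fun y => ?_)
    simp only
    ring
  rw [hsm] at hyG
  filter_upwards [hue, hyG] with x h1 h2
  rw [h1, h2]

/-! ### Choice of square roots and conclusion -/

/-- Of the two roots of `-z`, one has positive real part unless both are purely imaginary, and then
`z` lies in `[0, ∞)`. -/
theorem exists_sqrt_of_notMem {z : ℂ} (hz : z ∉ ((↑) : ℝ → ℂ) '' Set.Ici (0 : ℝ)) :
    ∃ κ : ℂ, 0 < κ.re ∧ z = -κ ^ 2 := by
  obtain ⟨κ, hκ⟩ := IsAlgClosed.exists_pow_nat_eq (-z) two_pos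
  have hz' : z = -κ ^ 2 := by rw [hκ, neg_neg]
  rcases lt_trichotomy κ.re 0 with h | h | h
  · exact ⟨-κ, by simpa using h, by rw [hz', neg_sq]⟩
  · refine absurd ⟨κ.im ^ 2, sq_nonneg κ.im, ?_⟩ hz
    have : κ = κ.im * Complex.I := by
      apply Complex.ext <;> simp [h]
    rw [hz', this, mul_pow, Complex.I_sq]
    simp
  · exact ⟨κ, h, hz'⟩

/-- The root is `-i √r e^{iθ/2}`, whose real part `√r sin(θ/2)` is the source of the sine in the
constant. -/
theorem polar_eq_neg_sq (r θ : ℝ) (hr : 0 ≤ r) :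
    (r : ℂ) * Complex.exp ((θ : ℂ) * Complex.I)
      = -((Real.sqrt r * Real.sin (θ / 2) : ℝ) - (Real.sqrt r * Real.cos (θ / 2) : ℝ) * Complex.I) ^ 2 := by
  have h1 : (r : ℂ) = (Real.sqrt r : ℂ) ^ 2 := by
    rw [← Complex.ofReal_pow, Real.sq_sqrt hr]
  have h2 : Complex.exp ((θ : ℂ) * Complex.I)
      = ((Real.cos (θ / 2) : ℝ) + (Real.sin (θ / 2) : ℝ) * Complex.I) ^ 2 := by
    rw [Complex.ofReal_cos, Complex.ofReal_sin, ← Complex.exp_mul_I, ← Complex.exp_nat_mul]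
    congr 1
    push_cast
    ring
  rw [h1, h2]
  push_cast
  linear_combination ((Real.sqrt r : ℂ) ^ 2) * (Complex.cos (θ / 2) ^ 2 + Complex.sin (θ / 2) ^ 2) *
    Complex.I_sq

end

theorem mainTheorem2 (p : ℝ≥0∞) [Fact (1 ≤ p)] (hp1 : 1 < p) (hp2 : p < ⊤)
    (γ : ℝ) (hγ1 : p ≤ 3 → 0 < γ) (hγ2 : 3 < p → p.toReal - 3 ≤ 2 * γ)
    (q : R3 → ℂ) (hq : MemLp q (ENNReal.ofReal (γ + 3 / 2)) volume)
    (a b : R3 → ℂ) (hab : ∀ᵐ x ∂(volume : Measure R3), q x = a x * b x)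
    (ha : IsStummel p.toReal.conjExponent a) (hb : IsStummel p.toReal b)
    (z : ℂ) (hz : z ∉ ((↑) : ℝ → ℂ) '' Set.Ici (0 : ℝ))
    (hQ : IsRegularPoint (borderedResolvent p a b z) (-1))
    (l : ℂ) (hl : l ∉ ((↑) : ℝ → ℂ) '' Set.Ici (0 : ℝ))
    (hev : IsEigenvalue (schrodingerOp p a b z) l)
    (θ : ℝ) (hθ : θ ∈ Set.Ioo 0 (2 * Real.pi))
    (hlθ : l = (‖l‖ : ℂ) * Complex.exp ((θ : ℂ) * Complex.I)) :
    ‖l‖ ^ γ ≤ lapSafConst γ θ * ∫ x : R3, ‖q x‖ ^ (γ + 3 / 2) := by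
  have hγ : 0 < γ := by
    rcases le_or_gt p 3 with h | h
    · exact hγ1 h
    · have h3 : (3 : ℝ) < p.toReal := by
        have := (ENNReal.toReal_lt_toReal (by norm_num) hp2.ne).2 h
        simpa using this
      linarith [hγ2 h]
  have hl0 : 0 < ‖l‖ := norm_pos_iff.2 fun h => hl ⟨0, Set.mem_Ici.2 le_rfl, by simp [h]⟩
  have hsin : 0 < Real.sin (θ / 2) :=
    Real.sin_pos_of_pos_of_lt_pi (by linarith [hθ.1]) (by linarith [hθ.2])
  obtain ⟨κ, hκ, rfl⟩ := exists_sqrt_of_notMem hz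
  obtain ⟨μ, hμre, hμl⟩ : ∃ μ : ℂ, μ.re = Real.sqrt ‖l‖ * Real.sin (θ / 2) ∧ l = -μ ^ 2 :=
    ⟨_, by simp only [Complex.sub_re, Complex.ofReal_re, Complex.re_ofReal_mul, Complex.I_re,
      mul_zero, sub_zero], hlθ.trans (polar_eq_neg_sq ‖l‖ θ hl0.le)⟩
  have hμ : 0 < μ.re := by rw [hμre]; positivity
  by_contra! hlt
  rw [hμl] at hev
  obtain ⟨u, g, hu0, hg, hgq, hu⟩ := exists_eigenfunction hp1 hp2 hκ hμ hab ha hQ hev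
  refine hu0 (Lp.ext ((ae_eq_zero_of_yukawa_equation hγ hq hμ ?_ hg hgq hu).trans
    (Lp.coeFn_zero _ _ _).symm))
  have hS : 0 < Real.sin (θ / 2) ^ (2 * γ) := by positivity
  -- This identity turns the negated conclusion into the smallness condition of
  -- `ae_eq_zero_of_yukawa_equation`.
  have hpow : μ.re ^ (2 * γ) = ‖l‖ ^ γ * Real.sin (θ / 2) ^ (2 * γ) := by
    rw [hμre, Real.mul_rpow (by positivity) hsin.le, Real.rpow_mul (by positivity),
      Real.rpow_two, Real.sq_sqrt hl0.le]
  rw [hpow, ← div_lt_iff₀ hS]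
  refine lt_of_eq_of_lt ?_ hlt
  rw [lapSafConst]
  field_simp
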